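/- Let $\mathcal U,\mathcal V,\mathcal X,\mathcal Y$ be finite alphabets, $P_{UV}$ a probability distribution on $\mathcal U\times\mathcal V$ with $H(U|V)>0$, $W=\{W(y|x)\}$ a discrete memoryless channel from $\mathcal X$ to $\mathcal Y$, $Q$ a probability distribution on $\mathcal X$, and $R>0$. All logarithms are to the base $2$, $a\wedge b=\min\{a,b\}$ and $[a]_+=\max\{0,a\}$. *System.* For block length $n$, let $(\mathbf U,\mathbf V)$ be $n$ independent copies of $(U,V)\sim P_{UV}$. Each $\mathbf u\in\mathcal U^n$ is independently assigned a bin $f(\mathbf u)$, uniform over $M=\lceil 2^{nR}\rceil$ bins. Independently of $f$, codewords $\mathbf x(1),\dots,\mathbf x(M)$ are drawn independently and uniformly from the type class $\mathcal T(Q_n)\subseteq\mathcal X^n$ of all sequences with empirical distribution $Q_n$. Here $n$ runs through any sequence of block lengths tending to infinity, and the $Q_n$ are any distributions with $\mathcal T(Q_n)\neq\emptyset$ and $Q_n\to Q$ (in particular $Q_n=Q$ along block lengths for which $\mathcal T(Q)\ne\emptyset$). The source vector $\mathbf u$ is transmitted as $\mathbf x[\mathbf u]=\mathbf x(f(\mathbf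 u))$ over the channel, so that the output $\mathbf y\in\mathcal Y^n$ has probability $W(\mathbf y|\mathbf x)=\prod_t W(y_t|x_t)$ given $\mathbf x=\mathbf x[\mathbf u]$. A decoder knows $f$ and the codewords and estimates $\mathbf u$ by $\hat{\mathbf u}$ from $\mathbf y$ and the side information $\mathbf v$. Its average error probability $\overline{P_e}$ is the probability of $\hat{\mathbf U}\ne\mathbf U$ under all the randomness, that of $f$ and of the codewords included. Its exponent is $\lim_{n\to\infty}\bigl[-\tfrac1n\log\overline{P_e}\bigr]$. Hats denote information measures of the joint empirical distributions of the indicated sequences. **Theorem 1.** Let $$E(R,Q)=\min_{P_{U'V'},\,W'}\Bigl\{D(P_{U'V'}\|P_{UV})+D(W'\|W|Q)+\bigl[R\wedge I(X;Y')-H(U'|V')\bigr]_+\Bigr\},$$ where the minimum is over all distributions $P_{U'V'}$ of $(U',V')$ on $\mathcal U\times\mathcal V$ and all channels $W'$ from $\mathcal X$ to $\mathcal Y$, $Y'$ is the output of $W'$ when its input is $X\sim Q$, $D(\cdot\|\cdot)\in[0,\infty]$ is the Kullback–Leibler divergence, and $D(W'\|W|Q)=\sum_x Q(x)D(W'(\cdot|x)\|W(\cdot|x))$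 with $0\cdot\infty=0$. The minimum is attained and finite, and the following holds, for every rule of breaking ties in the maxima. (a) The exponent of the MAP decoder $\hat{\mathbf u}=\arg\max_{\mathbf u}P(\mathbf u,\mathbf v)W(\mathbf y|\mathbf x[\mathbf u])$, where $P(\mathbf u,\mathbf v)=\prod_t P_{UV}(u_t,v_t)$, exists and equals $E(R,Q)$. (b) The exponents of the universal decoders $$\hat{\mathbf u}=\arg\max_{\mathbf u}\bigl[\hat I_{\mathbf x[\mathbf u]\mathbf y}(X;Y)-\hat H_{\mathbf u\mathbf v}(U|V)\bigr]\quad\text{and}\quad \hat{\mathbf u}=\arg\max_{\mathbf u}\bigl[R\wedge\hat I_{\mathbf x[\mathbf u]\mathbf y}(X;Y)-\hat H_{\mathbf u\mathbf v}(U|V)\bigr]$$ both exist and equal $E(R,Q)$ as well. -/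

import Mathlib

open Filter Topology

noncomputable section

namespace BinningExponent

/-! ### Information measures on finite alphabets (logarithms to the base 2) -/

/-- Shannon entropy `-∑ p(a) log p(a)`. -/
def entropy {A : Type*} [Fintype A] (p : A → ℝ) : ℝ :=
  -∑ a, p a * Real.logb 2 (p a)

/-- First marginal of a joint distribution. -/
def margFst {A B : Type*} [Fintype B] (p : A × B → ℝ) (a : A) : ℝ := ∑ b, p (a, b)

/-- Second marginal of a joint distribution. -/
def margSnd {A B : Type*} [Fintype A] (p : A × B → ℝ) (b : B) : ℝ := ∑ a, p (a, b)

/-- `H(A|B) = H(A,B) - H(B)`. -/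
def condEntropy {A B : Type*} [Fintype A] [Fintype B] (p : A × B → ℝ) : ℝ :=
  entropy p - entropy (margSnd p)

/-- `I(A;B) = H(A) + H(B) - H(A,B)`. -/
def mutualInfo {A B : Type*} [Fintype A] [Fintype B] (p : A × B → ℝ) : ℝ :=
  entropy (margFst p) + entropy (margSnd p) - entropy p

open Classical in
/-- Kullback–Leibler divergence `D(p‖q)`; it is `+∞` unless `p` vanishes wherever `q` does. -/
def relEntropy {A : Type*} [Fintype A] (p q : A → ℝ) : EReal :=
  if ∀ a, q a = 0 → p a = 0 then
    ((∑ a, p a * Real.logb 2 (p a / q a) : ℝ) : EReal)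
  else ⊤

/-- `D(W'‖W|Q) = ∑ₓ Q(x) D(W'(·|x)‖W(·|x))`, with `0 · ∞ = 0`. -/
def condRelEntropy {X Y : Type*} [Fintype X] [Fintype Y] (W' W : X → Y → ℝ) (Q : X → ℝ) : EReal :=
  ∑ x, (Q x : EReal) * relEntropy (W' x) (W x)

/-- The joint distribution of input and output of the channel `W` with input law `Q`. -/
def joint {X Y : Type*} (Q : X → ℝ) (W : X → Y → ℝ) : X × Y → ℝ :=
  fun xy => Q xy.1 * W xy.1 xy.2

/-- The functional
`D(P_{U'V'}‖P_{UV}) + D(W'‖W|Q) + [R ∧ I(X;Y') - H(U'|V')]₊` of `(P', W')`. -/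
def exponentObjective {U V X Y : Type*} [Fintype U] [Fintype V] [Fintype X] [Fintype Y]
    (P : U × V → ℝ) (W : X → Y → ℝ) (Q : X → ℝ) (R : ℝ)
    (P' : U × V → ℝ) (W' : X → Y → ℝ) : EReal :=
  relEntropy P' P + condRelEntropy W' W Q +
    ((max 0 (min R (mutualInfo (joint Q W')) - condEntropy P') : ℝ) : EReal)

/-- The values of the functional over all distributions `P'` on `U × V` and channels `W'`. -/
def exponentValues {U V X Y : Type*} [Fintype U] [Fintype V] [Fintype X] [Fintype Y]
    (P : U × V → ℝ) (W : X → Y → ℝ) (Q : X → ℝ) (R : ℝ) : Set EReal :=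
  {e | ∃ P' ∈ stdSimplex ℝ (U × V), ∃ W' : X → Y → ℝ,
    (∀ x, W' x ∈ stdSimplex ℝ Y) ∧ e = exponentObjective P W Q R P' W'}

/-! ### Empirical distributions and type classes -/

/-- The empirical distribution of a sequence of length `n`. -/
def empDist {A : Type*} [DecidableEq A] {n : ℕ} (x : Fin n → A) (a : A) : ℝ :=
  ((Finset.univ.filter fun i => x i = a).card : ℝ) / n

/-- The joint empirical distribution of two sequences of length `n`. -/
def empJoint {A B : Type*} [DecidableEq A] [DecidableEq B] {n : ℕ}
    (x : Fin n → A) (y : Fin n → B) : A × B → ℝ :=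
  empDist fun i => (x i, y i)

/-- The type class of `Q`: all sequences of length `n` with empirical distribution `Q`. It is empty
when `Q` is not a type of denominator `n`. -/
def typeClass {X : Type*} [Fintype X] [DecidableEq X] (n : ℕ) (Q : X → ℝ) :
    Finset (Fin n → X) :=
  Finset.univ.filter fun x => empDist x = Q

/-! ### The communication system -/

/-- The number of bins, `2^{nR}` rounded up to an integer. -/
def numBins (R : ℝ) (n : ℕ) : ℕ := ⌈(2 : ℝ) ^ ((n : ℝ) * R)⌉₊

/-- A binning code: it assigns a bin to every source vector. -/
abbrev Binning (U : Type*) (n M : ℕ) := (Fin n → U) → Fin M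

/-- A channel code: it assigns to every bin a codeword from the type class of `Q`. -/
abbrev Codebook {X : Type*} [Fintype X] [DecidableEq X] (n M : ℕ) (Q : X → ℝ) :=
  Fin M → ↥(typeClass n Q)

/-- A decoder knows the binning code and the channel code, and estimates the source vector from
the side information and the channel output. -/
abbrev Decoder (U V Y : Type*) {X : Type*} [Fintype X] [DecidableEq X] (n M : ℕ) (Q : X → ℝ) :=
  Binning U n M → Codebook n M Q → (Fin n → V) → (Fin n → Y) → (Fin n → U)

/-- `δ` is an arg-max decoder for a decoding metric `m(u, v, x, y)`, with any rule for breaking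
ties: its decision maximizes `m(u, v, x[u], y)` over all source vectors `u`, where `x[u]` is the
codeword of the bin of `u`. -/
def IsArgmaxDecoder {U V X Y : Type*} [Fintype X] [DecidableEq X] {n M : ℕ} {Q : X → ℝ}
    (m : (Fin n → U) → (Fin n → V) → (Fin n → X) → (Fin n → Y) → ℝ)
    (δ : Decoder U V Y n M Q) : Prop :=
  ∀ (f : Binning U n M) (C : Codebook n M Q) (v : Fin n → V) (y : Fin n → Y) (u : Fin n → U),
    m u v (C (f u)) y ≤ m (δ f C v y) v (C (f (δ f C v y))) y

/-- The average probability of the event that the decision differs from the source vector. The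
binning code and the channel code are uniform and independent, the source and its side information
are memoryless with law `P`, and the channel is memoryless with transition probabilities `W`. -/
def errorProb {U V X Y : Type*} [Fintype U] [Fintype V] [Fintype X] [Fintype Y]
    [DecidableEq U] [DecidableEq X] {n M : ℕ} {Q : X → ℝ}
    (P : U × V → ℝ) (W : X → Y → ℝ) (δ : Decoder U V Y n M Q) : ℝ :=
  (∑ f : Binning U n M, ∑ C : Codebook n M Q,
    ∑ u : Fin n → U, ∑ v : Fin n → V, ∑ y : Fin n → Y,
      if δ f C v y ≠ u then
        (∏ i, P (u i, v i)) * ∏ i, W ((C (f u)).1 i) (y i)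
      else 0) /
  ((Fintype.card (Binning U n M) : ℝ) * Fintype.card (Codebook n M Q))

/-- The metric of the MAP decoder, `P(u, v) W(y|x)`. -/
def mapMetric {U V X Y : Type*} {n : ℕ} (P : U × V → ℝ) (W : X → Y → ℝ)
    (u : Fin n → U) (v : Fin n → V) (x : Fin n → X) (y : Fin n → Y) : ℝ :=
  (∏ i, P (u i, v i)) * ∏ i, W (x i) (y i)

/-- The generalized MMI metric, `Î(X;Y) - Ĥ(U|V)`. -/
def gmmiMetric {U V X Y : Type*} [Fintype U] [Fintype V] [Fintype X] [Fintype Y]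
    [DecidableEq U] [DecidableEq V] [DecidableEq X] [DecidableEq Y] {n : ℕ}
    (u : Fin n → U) (v : Fin n → V) (x : Fin n → X) (y : Fin n → Y) : ℝ :=
  mutualInfo (empJoint x y) - condEntropy (empJoint u v)

/-- The variant metric, `R ∧ Î(X;Y) - Ĥ(U|V)`. -/
def gmmiMetric' {U V X Y : Type*} [Fintype U] [Fintype V] [Fintype X] [Fintype Y]
    [DecidableEq U] [DecidableEq V] [DecidableEq X] [DecidableEq Y] {n : ℕ} (R : ℝ)
    (u : Fin n → U) (v : Fin n → V) (x : Fin n → X) (y : Fin n → Y) : ℝ :=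
  min R (mutualInfo (empJoint x y)) - condEntropy (empJoint u v)

/-- The probabilities `p k` at block lengths `n k` have the exponent `E`: they are eventually
positive (so that the logarithm is meaningful) and `-(1/n) log p → E`. -/
def HasExponent (n : ℕ → ℕ) (p : ℕ → ℝ) (E : ℝ) : Prop :=
  (∀ᶠ k in atTop, 0 < p k) ∧
    Tendsto (fun k => -Real.logb 2 (p k) / (n k : ℝ)) atTop (𝓝 E)

end BinningExponent

end

/-!
The argument is the method of types. The pairs `(u, v)` and `(x, y)` have only polynomially many
joint types, so up to polynomial factors the error probability is governed by its value given the
joint types, and the probability of two joint types is `2 ^ (-n D)` with the two divergences of the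
exponent.

For a universal metric, a word beating the true one has an empirical margin `I - H` at least that of
the true one clipped at `R`. A union bound over such words, itself clipped at `1`, yields the factor
`2 ^ (-n [R ∧ I - H]₊)`; the minimum with `R` comes from words in the bin of the true one.

Conversely, whatever the decoder, the words with the same joint type with `v` as the true one, and
a codeword with the same joint type with `y`, are exactly as likely as the true one, so that half of
the decisions are wrong as soon as there is another such word. A second moment bound shows that
there is one with probability about `2 ^ (-n [R ∧ I - H]₊)`, provided that `H > 0` makes the number
of candidates large.

The MAP decoder minimizes the error probability, hence is caught between the converse and a
universal decoder. Continuity of the exponent function in the joint distributions and compactness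
lead from joint types to the minimum; moving the source distribution slightly towards `P` secures
`H > 0` in the converse.
-/

noncomputable section

namespace BinningExponent

open Finset
open scoped BigOperators

/-! ### Types and type classes -/

section Types

variable {A B : Type*} [DecidableEq A] [DecidableEq B] {n : ℕ}

/-- Absolute continuity `p ≪ q` of mass functions: `p` vanishes wherever `q` does. -/
def IsDominatedBy {A : Type*} (p q : A → ℝ) : Prop :=
  ∀ a, q a = 0 → p a = 0

/-- The cross entropy `-∑ p(a) log q(a)`; when `p ≪ q` it exceeds the entropy of `p` by the
divergence `D(p‖q)`. It is finite, and hence meaningless, when `p ≪ q` fails. -/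
def crossEntropy {A : Type*} [Fintype A] (p q : A → ℝ) : ℝ :=
  -∑ a, p a * Real.logb 2 (q a)

/-- The sequences `u` whose joint type with `v` is `p`. -/
def condTypeClass [Fintype A] [Fintype B] (v : Fin n → B) (p : A × B → ℝ) : Finset (Fin n → A) :=
  {u | empJoint u v = p}

theorem empDist_nonneg (x : Fin n → A) (a : A) : 0 ≤ empDist x a := by
  unfold empDist; positivity

theorem empDist_apply_pos (x : Fin n → A) (i : Fin n) : 0 < empDist x (x i) := by
  have hcard : 0 < #{j | x j = x i} := card_pos.2 ⟨i, by simp⟩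
  have hn : 0 < n := i.pos
  unfold empDist; positivity

theorem natCast_mul_empDist (x : Fin n → A) (a : A) :
    (n : ℝ) * empDist x a = #{i | x i = a} := by
  rcases n.eq_zero_or_pos with rfl | hn
  · simp
  · unfold empDist; field_simp

theorem sum_empDist_mul [Fintype A] (x : Fin n → A) (g : A → ℝ) :
    (n : ℝ) * ∑ a, empDist x a * g a = ∑ i, g (x i) := by
  rw [← sum_fiberwise' univ x g, mul_sum]
  exact sum_congr rfl fun a _ => by
    rw [sum_const, nsmul_eq_mul, ← mul_assoc, natCast_mul_empDist]

theorem sum_empDist_pow [Fintype A] (x : Fin n → A) : (∑ a, empDist x a) ^ n = 1 := by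
  rcases n.eq_zero_or_pos with rfl | hn
  · simp
  have h : (n : ℝ) * ∑ a, empDist x a = n * 1 := by simpa using sum_empDist_mul x fun _ => 1
  rw [mul_left_cancel₀ (by positivity) h, one_pow]

theorem empDist_mem_stdSimplex [Fintype A] (hn : n ≠ 0) (x : Fin n → A) :
    empDist x ∈ stdSimplex ℝ A :=
  ⟨empDist_nonneg x, (pow_eq_one_iff_of_nonneg (sum_nonneg fun a _ => empDist_nonneg x a) hn).1
    (sum_empDist_pow x)⟩

theorem margFst_empJoint [Fintype B] (x : Fin n → A) (y : Fin n → B) :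
    margFst (empJoint x y) = empDist x := by
  funext a
  unfold margFst empJoint empDist
  rw [← sum_div, ← Nat.cast_sum, card_eq_sum_card_fiberwise (f := y) (t := univ) (by simp)]
  simp only [filter_filter, Prod.ext_iff]

theorem margSnd_empJoint [Fintype A] (x : Fin n → A) (y : Fin n → B) :
    margSnd (empJoint x y) = empDist y := by
  funext b
  unfold margSnd empJoint empDist
  rw [← sum_div, ← Nat.cast_sum, card_eq_sum_card_fiberwise (f := x) (t := univ) (by simp)]
  simp only [filter_filter, Prod.ext_iff, and_comm]

theorem empDist_comp_perm (x : Fin n → A) (σ : Equiv.Perm (Fin n)) :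
    empDist (x ∘ σ) = empDist x := by
  funext a
  unfold empDist
  congr 2
  exact card_equiv σ (by simp)

theorem card_filter_eq_of_empDist_eq {x y : Fin n → A} (h : empDist x = empDist y) (a : A) :
    #{i | x i = a} = #{i | y i = a} := by
  have hcast : (#{i | x i = a} : ℝ) = #{i | y i = a} := by
    rw [← natCast_mul_empDist, ← natCast_mul_empDist, h]
  exact_mod_cast hcast

theorem exists_perm_of_empDist_eq {x y : Fin n → A} (h : empDist x = empDist y) :
    ∃ σ : Equiv.Perm (Fin n), y ∘ σ = x := by
  have e (a : A) : Nonempty ({i // x i = a} ≃ {i // y i = a}) :=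
    ⟨Fintype.equivOfCardEq (by
      simpa only [Fintype.card_subtype] using card_filter_eq_of_empDist_eq h a)⟩
  refine ⟨(Equiv.sigmaFiberEquiv x).symm.trans
    ((Equiv.sigmaCongrRight fun a => (e a).some).trans (Equiv.sigmaFiberEquiv y)), ?_⟩
  funext i
  exact ((e (x i)).some ⟨i, rfl⟩).2

theorem mem_typeClass [Fintype A] {p : A → ℝ} {x : Fin n → A} :
    x ∈ typeClass n p ↔ empDist x = p := by simp [typeClass]

theorem mem_condTypeClass [Fintype A] [Fintype B] {p : A × B → ℝ} {u : Fin n → A} {v : Fin n → B} :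
    u ∈ condTypeClass v p ↔ empJoint u v = p := by simp [condTypeClass]

theorem card_condTypeClass_comp_perm [Fintype A] [Fintype B] (v : Fin n → B) (p : A × B → ℝ)
    (σ : Equiv.Perm (Fin n)) : #(condTypeClass (v ∘ σ) p) = #(condTypeClass v p) := by
  refine (card_equiv (σ.arrowCongr (Equiv.refl A)).symm fun u => ?_).symm
  have hσ : empJoint (u ∘ σ) (v ∘ σ) = empJoint u v :=
    empDist_comp_perm (fun i => (u i, v i)) σ
  rw [mem_condTypeClass, mem_condTypeClass]
  exact hσ ▸ Iff.rfl

theorem card_typeClass_eq_sum [Fintype A] [Fintype B] (n : ℕ) (p : A × B → ℝ) :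
    #(typeClass n p) = ∑ v : Fin n → B, #(condTypeClass (A := A) v p) := by
  rw [card_eq_sum_card_fiberwise (f := fun z i => (z i).2) (t := univ) (by simp)]
  refine sum_congr rfl fun v _ => card_bij' (fun z _ i => (z i).1) (fun u _ i => (u i, v i))
    ?_ ?_ ?_ ?_
  · rintro z hz
    obtain ⟨hzp, rfl⟩ := mem_filter.1 hz
    exact mem_condTypeClass.2 (mem_typeClass.1 hzp)
  · exact fun u hu => mem_filter.2 ⟨mem_typeClass.2 (mem_condTypeClass.1 hu), rfl⟩
  · rintro z hz
    obtain ⟨-, rfl⟩ := mem_filter.1 hz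
    rfl
  · exact fun u _ => rfl

theorem condTypeClass_eq_empty [Fintype A] [Fintype B] {v : Fin n → B} {p : A × B → ℝ}
    (hv : empDist v ≠ margSnd p) : condTypeClass v p = ∅ :=
  eq_empty_of_forall_notMem fun u hu => hv <| by
    rw [← mem_condTypeClass.1 hu, margSnd_empJoint]

theorem card_condTypeClass_mul_card_typeClass [Fintype A] [Fintype B] {p : A × B → ℝ}
    {v : Fin n → B} (hv : empDist v = margSnd p) :
    #(condTypeClass v p) * #(typeClass n (margSnd p)) = #(typeClass n p) := by
  have hperm : ∀ w ∈ typeClass n (margSnd p), #(condTypeClass (A := A) w p) =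
      #(condTypeClass v p) := fun w hw => by
    obtain ⟨σ, rfl⟩ := exists_perm_of_empDist_eq ((mem_typeClass.1 hw).trans hv.symm)
    exact card_condTypeClass_comp_perm v p σ
  rw [card_typeClass_eq_sum, mul_comm, ← smul_eq_mul, ← sum_const, ← sum_congr rfl hperm]
  refine sum_subset (subset_univ _) fun w _ hw => ?_
  rw [condTypeClass_eq_empty (mem_typeClass.not.1 hw), card_empty]

theorem card_filter_empJoint_eq [Fintype A] [Fintype B] {Q : A → ℝ} {y : Fin n → B}
    {J : A × B → ℝ} (hJ : margFst J = Q) :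
    #{x : ↥(typeClass n Q) | empJoint x.1 y = J} = #(condTypeClass y J) := by
  refine card_bij (fun x _ => x.1) (fun x hx => mem_condTypeClass.2 (mem_filter.1 hx).2)
    (fun _ _ _ _ => Subtype.ext) fun x hx => ?_
  have hxJ := mem_condTypeClass.1 hx
  exact ⟨⟨x, mem_typeClass.2 (by rw [← margFst_empJoint x y, hxJ, hJ])⟩,
    mem_filter.2 ⟨mem_univ _, hxJ⟩, rfl⟩

/-! ### Sizes of type classes -/

theorem prod_comp_eq_two_rpow [Fintype A] {g : A → ℝ} (hg : 0 ≤ g) {x : Fin n → A}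
    (h : IsDominatedBy (empDist x) g) :
    ∏ i, g (x i) = (2 : ℝ) ^ (-(n * crossEntropy (empDist x) g)) := by
  have hpos (i : Fin n) : 0 < g (x i) :=
    (hg _).lt_of_ne fun h0 => (empDist_apply_pos x i).ne' (h _ h0.symm)
  rw [crossEntropy, mul_neg, neg_neg, sum_empDist_mul x fun a => Real.logb 2 (g a),
    Real.rpow_sum_of_pos two_pos]
  exact prod_congr rfl fun i _ => (Real.rpow_logb two_pos (by norm_num) (hpos i)).symm

theorem prod_comp_eq_zero {g : A → ℝ} {x : Fin n → A} (h : ¬IsDominatedBy (empDist x) g) :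
    ∏ i, g (x i) = 0 := by
  obtain ⟨a, hga, hxa⟩ : ∃ a, g a = 0 ∧ empDist x a ≠ 0 := by simpa [IsDominatedBy] using h
  have hcard : #{i | x i = a} ≠ 0 := fun hc => hxa (by simp [empDist, hc])
  obtain ⟨i, hi⟩ := card_ne_zero.1 hcard
  exact prod_eq_zero (mem_univ i) (by rw [(mem_filter.1 hi).2, hga])

theorem prod_comp_eq_of_empDist_eq {x y : Fin n → A} (h : empDist x = empDist y) (g : A → ℝ) :
    ∏ i, g (x i) = ∏ i, g (y i) := by
  obtain ⟨σ, rfl⟩ := exists_perm_of_empDist_eq h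
  exact Equiv.prod_comp σ fun i => g (y i)

theorem prod_empDist_self [Fintype A] (x : Fin n → A) :
    ∏ i, empDist x (x i) = (2 : ℝ) ^ (-(n * entropy (empDist x))) :=
  prod_comp_eq_two_rpow (empDist_nonneg x) fun _ => id

theorem card_typeClass_le [Fintype A] (n : ℕ) (p : A → ℝ) :
    (#(typeClass n p) : ℝ) ≤ (2 : ℝ) ^ (n * entropy p) := by
  rcases (typeClass n p).eq_empty_or_nonempty with h | ⟨x, hx⟩
  · rw [h, card_empty, Nat.cast_zero]; positivity
  obtain rfl := mem_typeClass.1 hx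
  rw [← one_mul ((2 : ℝ) ^ _), ← div_le_iff₀ (by positivity), div_eq_mul_inv,
    ← Real.rpow_neg zero_le_two]
  calc #(typeClass n (empDist x)) * (2 : ℝ) ^ (-(n * entropy (empDist x)))
      = ∑ y ∈ typeClass n (empDist x), ∏ i, empDist x (y i) := by
        rw [sum_congr rfl fun y hy => prod_comp_eq_of_empDist_eq (mem_typeClass.1 hy) (empDist x),
          sum_const, nsmul_eq_mul, prod_empDist_self]
    _ ≤ ∑ y : Fin n → A, ∏ i, empDist x (y i) :=
        sum_le_sum_of_subset_of_nonneg (subset_univ _) fun y _ _ =>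
          prod_nonneg fun i _ => empDist_nonneg x _
    _ = 1 := by rw [← Fintype.sum_pow, sum_empDist_pow]

open Nat in
theorem card_typeClass_mul_prod_factorial [Fintype A] (x : Fin n → A) :
    #(typeClass n (empDist x)) * ∏ a, (#{i | x i = a})! = n ! := by
  have horbit : (typeClass n (empDist x) : Set (Fin n → A)) =
      MulAction.orbit (DomMulAct (Equiv.Perm (Fin n))) x := by
    ext y
    refine mem_typeClass.trans ⟨fun h => ?_, ?_⟩
    · obtain ⟨σ, rfl⟩ := exists_perm_of_empDist_eq h
      exact ⟨DomMulAct.mk σ, rfl⟩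
    · rintro ⟨σ, rfl⟩
      exact empDist_comp_perm x (DomMulAct.mk.symm σ)
  have hstab : Nat.card (MulAction.stabilizer (DomMulAct (Equiv.Perm (Fin n))) x) =
      ∏ a, (#{i | x i = a})! := by
    rw [Nat.card_congr MulOpposite.opEquiv,
      Nat.card_congr (DomMulAct.stabilizerMulEquiv x).toEquiv, Nat.card_pi]
    simp only [Nat.card_eq_fintype_card, Fintype.card_perm, Fintype.card_subtype]
  rw [← hstab, ← Set.ncard_coe_finset, horbit, ← MulAction.index_stabilizer,
    Subgroup.index_mul_card,
    Nat.card_congr DomMulAct.mk.symm, Nat.card_perm, Nat.card_fin]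

open Nat in
theorem factorial_mul_pow_le (k l : ℕ) : k ! * k ^ l ≤ l ! * k ^ k := by
  rcases le_total k l with h | h
  · calc k ! * k ^ l = k ! * k ^ (l - k) * k ^ k := by
          rw [mul_assoc, ← pow_add, Nat.sub_add_cancel h]
      _ ≤ l ! * k ^ k := by gcongr; exact Nat.factorial_mul_pow_sub_le_factorial h
  · calc k ! * k ^ l = l ! * k.descFactorial (k - l) * k ^ l := by
          rw [← Nat.factorial_mul_descFactorial (Nat.sub_le k l), Nat.sub_sub_self h]
      _ ≤ l ! * k ^ (k - l) * k ^ l := by gcongr; exact Nat.descFactorial_le_pow _ _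
      _ = l ! * k ^ k := by rw [mul_assoc, ← pow_add, Nat.sub_add_cancel h]

open Nat in
/-- Under the memoryless law with letter distribution `p`, no type class is more likely than that
of `p` itself. -/
theorem card_typeClass_mul_prod_le [Fintype A] (x y : Fin n → A) :
    #(typeClass n (empDist y)) * ∏ i, empDist x (y i) ≤
      #(typeClass n (empDist x)) * ∏ i, empDist x (x i) := by
  set k : A → ℕ := fun a => #{i | x i = a}
  set l : A → ℕ := fun a => #{i | y i = a}
  have hprod (z : Fin n → A) :
      ∏ i, empDist x (z i) = (∏ a, k a ^ #{i | z i = a} : ℕ) / (n : ℝ) ^ n := by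
    have hz : ∏ i, (k (z i) : ℝ) = (∏ a, k a ^ #{i | z i = a} : ℕ) := by
      rw [← prod_fiberwise' univ z fun a => (k a : ℝ)]
      push_cast
      simp only [prod_const]
    rw [← hz, ← Fin.prod_const, ← prod_div_distrib]
    rfl
  have hle : (#(typeClass n (empDist y)) * ∏ a, k a ^ l a) * ((∏ a, (l a)!) * ∏ a, (k a)!) ≤
      (#(typeClass n (empDist x)) * ∏ a, k a ^ k a) * ((∏ a, (l a)!) * ∏ a, (k a)!) := by
    calc _ = (#(typeClass n (empDist y)) * ∏ a, (l a)!) * ∏ a, (k a)! * k a ^ l a := by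
          rw [prod_mul_distrib]; ring
      _ ≤ (#(typeClass n (empDist x)) * ∏ a, (k a)!) * ∏ a, (l a)! * k a ^ k a := by
          rw [card_typeClass_mul_prod_factorial, card_typeClass_mul_prod_factorial]
          exact mul_le_mul_right (prod_le_prod' fun a _ => factorial_mul_pow_le _ _) _
      _ = _ := by rw [prod_mul_distrib]; ring
  have hpos : 0 < (∏ a, (l a)!) * ∏ a, (k a)! :=
    mul_pos (prod_pos fun a _ => Nat.factorial_pos _) (prod_pos fun a _ => Nat.factorial_pos _)
  rw [hprod, hprod, ← mul_div_assoc, ← mul_div_assoc]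
  refine div_le_div_of_nonneg_right ?_ (by positivity)
  exact_mod_cast le_of_mul_le_mul_right hle hpos

theorem card_image_empDist_le [Fintype A] :
    #(univ.image (empDist : (Fin n → A) → A → ℝ)) ≤ (n + 1) ^ Fintype.card A := by
  have hsub : univ.image (empDist : (Fin n → A) → A → ℝ) ⊆
      (univ : Finset (A → Fin (n + 1))).image fun k a => ((k a : ℕ) : ℝ) / n := by
    refine image_subset_iff.2 fun x _ => mem_image.2
      ⟨fun a => ⟨#{i | x i = a}, Nat.lt_succ_of_le ?_⟩, mem_univ _, rfl⟩
    simpa using card_le_univ {i | x i = a}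
  simpa using (card_le_card hsub).trans card_image_le

theorem le_card_typeClass [Fintype A] {p : A → ℝ} (hp : (typeClass n p).Nonempty) :
    (2 : ℝ) ^ (n * entropy p) ≤ ((n : ℝ) + 1) ^ Fintype.card A * #(typeClass n p) := by
  obtain ⟨x, hx⟩ := hp
  obtain rfl := mem_typeClass.1 hx
  rw [← one_mul ((2 : ℝ) ^ _), ← le_div_iff₀ (by positivity), div_eq_mul_inv,
    ← Real.rpow_neg zero_le_two, ← prod_empDist_self, mul_assoc]
  set w : ℝ := #(typeClass n (empDist x)) * ∏ i, empDist x (x i)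
  have hw : 0 ≤ w := mul_nonneg (Nat.cast_nonneg _) (prod_nonneg fun i _ => empDist_nonneg x _)
  calc (1 : ℝ) = ∑ y : Fin n → A, ∏ i, empDist x (y i) := by
        rw [← Fintype.sum_pow, sum_empDist_pow]
    _ = ∑ q ∈ univ.image (empDist : (Fin n → A) → A → ℝ), ∑ y ∈ typeClass n q,
          ∏ i, empDist x (y i) :=
        (sum_fiberwise_of_maps_to (fun y hy => mem_image_of_mem _ hy) _).symm
    _ ≤ ∑ _q ∈ univ.image (empDist : (Fin n → A) → A → ℝ), w := sum_le_sum fun q hq => ?_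
    _ ≤ ((n : ℝ) + 1) ^ Fintype.card A * w := by
        rw [sum_const, nsmul_eq_mul]
        gcongr
        exact_mod_cast card_image_empDist_le
  obtain ⟨y, -, rfl⟩ := mem_image.1 hq
  rw [sum_congr rfl fun z hz => prod_comp_eq_of_empDist_eq (mem_typeClass.1 hz) (empDist x),
    sum_const, nsmul_eq_mul]
  exact card_typeClass_mul_prod_le x y

end Types

/-! ### Sums over sequences -/

section Sums

variable {A B : Type*} [Fintype A] [Fintype B] {n : ℕ}

theorem natCast_mul_condEntropy (n : ℕ) (p : A × B → ℝ) :
    n * condEntropy p = n * entropy p - n * entropy (margSnd p) :=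
  mul_sub _ _ _

theorem mutualInfo_eq_sub (p : A × B → ℝ) :
    mutualInfo p = entropy (margFst p) - condEntropy p := by
  unfold mutualInfo condEntropy; ring

theorem sum_sum_prodMk (g : (Fin n → A × B) → ℝ) :
    ∑ u : Fin n → A, ∑ v : Fin n → B, g (fun i => (u i, v i)) = ∑ z, g z := by
  rw [← Fintype.sum_prod_type' (f := fun (u : Fin n → A) (v : Fin n → B) => g fun i => (u i, v i))]
  exact (Equiv.arrowProdEquivProdArrow (Fin n) (fun _ => A) (fun _ => B)).symm.sum_comp g

variable [DecidableEq A] [DecidableEq B]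

theorem le_card_condTypeClass {p : A × B → ℝ} (hp : (typeClass n p).Nonempty) {v : Fin n → B}
    (hv : empDist v = margSnd p) :
    (2 : ℝ) ^ (n * condEntropy p) ≤
      ((n : ℝ) + 1) ^ Fintype.card (A × B) * #(condTypeClass v p) := by
  have hcard : (#(condTypeClass v p) * #(typeClass n (margSnd p)) : ℝ) = #(typeClass n p) := by
    exact_mod_cast card_condTypeClass_mul_card_typeClass hv
  rw [natCast_mul_condEntropy, Real.rpow_sub two_pos, div_le_iff₀ (by positivity)]
  calc (2 : ℝ) ^ (n * entropy p)
      ≤ ((n : ℝ) + 1) ^ Fintype.card (A × B) * #(typeClass n p) := le_card_typeClass hp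
    _ = ((n : ℝ) + 1) ^ Fintype.card (A × B) * #(condTypeClass v p) *
          #(typeClass n (margSnd p)) := by rw [← hcard, mul_assoc]
    _ ≤ ((n : ℝ) + 1) ^ Fintype.card (A × B) * #(condTypeClass v p) *
          2 ^ (n * entropy (margSnd p)) := by gcongr; exact card_typeClass_le n _

theorem card_condTypeClass_le (v : Fin n → B) (p : A × B → ℝ) :
    (#(condTypeClass v p) : ℝ) ≤ ((n : ℝ) + 1) ^ Fintype.card B * 2 ^ (n * condEntropy p) := by
  by_cases hv : empDist v = margSnd p
  swap
  · rw [condTypeClass_eq_empty hv, card_empty, Nat.cast_zero]; positivity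
  have hcard : (#(condTypeClass v p) * #(typeClass n (margSnd p)) : ℝ) = #(typeClass n p) := by
    exact_mod_cast card_condTypeClass_mul_card_typeClass hv
  have hne : (typeClass n (margSnd p)).Nonempty := ⟨v, mem_typeClass.2 hv⟩
  rw [natCast_mul_condEntropy, Real.rpow_sub two_pos, ← mul_div_assoc, le_div_iff₀ (by positivity)]
  calc #(condTypeClass v p) * (2 : ℝ) ^ (n * entropy (margSnd p))
      ≤ #(condTypeClass v p) *
          (((n : ℝ) + 1) ^ Fintype.card B * #(typeClass n (margSnd p))) := by
        gcongr; exact le_card_typeClass hne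
    _ = ((n : ℝ) + 1) ^ Fintype.card B * #(typeClass n p) := by rw [← hcard]; ring
    _ ≤ ((n : ℝ) + 1) ^ Fintype.card B * 2 ^ (n * entropy p) := by
        gcongr; exact card_typeClass_le n p

theorem sum_two_rpow_entropy_le (A : Type*) [Fintype A] [DecidableEq A] (n : ℕ) :
    ∑ z : Fin n → A, (2 : ℝ) ^ (-(n * entropy (empDist z))) ≤ ((n : ℝ) + 1) ^ Fintype.card A := by
  rw [sum_comp (fun p => (2 : ℝ) ^ (-(n * entropy p))) empDist]
  refine (sum_le_card_nsmul _ _ 1 fun p _ => ?_).trans ?_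
  · rw [nsmul_eq_mul, Real.rpow_neg zero_le_two, ← div_eq_mul_inv, div_le_one (by positivity)]
    exact card_typeClass_le n p
  · rw [nsmul_one]
    exact_mod_cast card_image_empDist_le

theorem sum_two_rpow_condEntropy_le (A : Type*) [Fintype A] [DecidableEq A] (v : Fin n → B) :
    ∑ u : Fin n → A, (2 : ℝ) ^ (-(n * condEntropy (empJoint u v))) ≤
      ((n : ℝ) + 1) ^ (Fintype.card (A × B) + Fintype.card B) := by
  rw [sum_comp (fun p => (2 : ℝ) ^ (-(n * condEntropy p))) fun u : Fin n → A => empJoint u v,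
    pow_add]
  refine (sum_le_card_nsmul _ _ (((n : ℝ) + 1) ^ Fintype.card B) fun p _ => ?_).trans ?_
  · rw [nsmul_eq_mul, Real.rpow_neg zero_le_two, ← div_eq_mul_inv, div_le_iff₀ (by positivity)]
    exact card_condTypeClass_le v p
  · have hsub : univ.image (fun u : Fin n → A => empJoint u v) ⊆
        univ.image (empDist : (Fin n → A × B) → A × B → ℝ) :=
      image_subset_iff.2 fun u _ => mem_image_of_mem empDist (mem_univ fun i => (u i, v i))
    rw [nsmul_eq_mul]
    gcongr
    exact_mod_cast (card_le_card hsub).trans card_image_empDist_le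

end Sums

/-! ### Approximation by types -/

section Approximation

variable {A : Type*} [Fintype A]

theorem exists_card_filter_eq [DecidableEq A] {n : ℕ} (k : A → ℕ) (hk : ∑ a, k a = n) :
    ∃ x : Fin n → A, ∀ a, #{i | x i = a} = k a := by
  have e : Fin n ≃ (Σ a, Fin (k a)) := Fintype.equivOfCardEq (by simp [hk])
  refine ⟨fun i => (e i).1, fun a => ?_⟩
  rw [← Fintype.card_subtype, ← Fintype.card_congr (e.symm.subtypeEquiv (p := fun s => s.1 = a)
    fun s => by simp), Fintype.card_congr (Equiv.sigmaSubtype a), Fintype.card_fin]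

theorem sum_floor_le_and_le_sum_floor {p : A → ℝ} (hp : p ∈ stdSimplex ℝ A) (N : ℕ) :
    ∑ a, ⌊N * p a⌋₊ ≤ N ∧ N ≤ ∑ a, ⌊N * p a⌋₊ + Fintype.card A := by
  have hN : ∑ a, N * p a = N := by rw [← mul_sum, hp.2, mul_one]
  have hle : ∑ a, (⌊N * p a⌋₊ : ℝ) ≤ N :=
    (sum_le_sum fun a _ => Nat.floor_le (mul_nonneg N.cast_nonneg (hp.1 a))).trans_eq hN
  have hge : (N : ℝ) ≤ ∑ a, ((⌊N * p a⌋₊ : ℝ) + 1) :=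
    hN.ge.trans (sum_le_sum fun a _ => (Nat.lt_floor_add_one _).le)
  rw [sum_add_distrib, sum_const, card_univ, nsmul_one] at hge
  exact ⟨by exact_mod_cast hle, by exact_mod_cast hge⟩

theorem exists_sum_eq_of_mem_stdSimplex {p : A → ℝ} (hp : p ∈ stdSimplex ℝ A) (N : ℕ) :
    ∃ k : A → ℕ, ∑ a, k a = N ∧ (∀ a, p a = 0 → k a = 0) ∧
      ∀ a, |(k a : ℝ) - N * p a| ≤ Fintype.card A := by
  classical
  obtain ⟨a₀, ha₀⟩ : ∃ a, p a ≠ 0 := by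
    by_contra! h
    exact zero_ne_one ((sum_eq_zero fun a _ => h a).symm.trans hp.2)
  obtain ⟨hle, hge⟩ := sum_floor_le_and_le_sum_floor hp N
  set S : ℕ := ∑ a, ⌊N * p a⌋₊
  have hle' : (S : ℝ) ≤ N := by exact_mod_cast hle
  have hge' : (N : ℝ) ≤ S + Fintype.card A := by exact_mod_cast hge
  have hcard : (1 : ℝ) ≤ Fintype.card A := by exact_mod_cast Fintype.card_pos_iff.2 ⟨a₀⟩
  refine ⟨fun a => ⌊N * p a⌋₊ + if a = a₀ then N - S else 0, ?_, fun a ha => ?_, fun a => ?_⟩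
  · rw [sum_add_distrib, sum_ite_eq', if_pos (mem_univ _), Nat.add_sub_cancel' hle]
  · have hne : a ≠ a₀ := fun h => ha₀ (h ▸ ha)
    simp [ha, hne]
  · have hfloor := Nat.floor_le (mul_nonneg N.cast_nonneg (hp.1 a))
    have hfloor' := Nat.lt_floor_add_one (N * p a)
    dsimp only
    split_ifs <;> push_cast [Nat.cast_sub hle] <;> rw [abs_le] <;> constructor <;> linarith

theorem exists_typeClass_nonempty_abs_sub_le [DecidableEq A] {p : A → ℝ}
    (hp : p ∈ stdSimplex ℝ A) (n : ℕ) :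
    ∃ p' : A → ℝ, (typeClass n p').Nonempty ∧ IsDominatedBy p' p ∧
      ∀ a, n * |p' a - p a| ≤ Fintype.card A := by
  obtain ⟨k, hk, h0, hle⟩ := exists_sum_eq_of_mem_stdSimplex hp n
  obtain ⟨x, hx⟩ := exists_card_filter_eq k hk
  refine ⟨empDist x, ⟨x, mem_typeClass.2 rfl⟩, fun a ha => by simp [empDist, hx, h0 a ha],
    fun a => ?_⟩
  simpa only [← hx, ← natCast_mul_empDist, ← mul_sub, abs_mul, Nat.abs_cast] using hle a

theorem exists_typeClass_nonempty_margFst_eq {X Y : Type*} [Fintype X] [Fintype Y] [DecidableEq X]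
    [DecidableEq Y] {W : X → Y → ℝ} (hW : ∀ x, W x ∈ stdSimplex ℝ Y) {n : ℕ} {Q : X → ℝ}
    (hQ : (typeClass n Q).Nonempty) :
    ∃ J : X × Y → ℝ, (typeClass n J).Nonempty ∧ margFst J = Q ∧
      IsDominatedBy J (Function.uncurry W) ∧
      ∀ b, n * |J b - joint Q W b| ≤ Fintype.card Y := by
  obtain ⟨x₀, hx₀⟩ := hQ
  obtain rfl := mem_typeClass.1 hx₀
  choose k hk h0 hle using fun x => exists_sum_eq_of_mem_stdSimplex (hW x) #{i | x₀ i = x}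
  have hsum : ∑ b : X × Y, k b.1 b.2 = n := by
    rw [Fintype.sum_prod_type, sum_congr rfl fun x _ => hk x,
      sum_card_fiberwise_eq_card_filter, filter_true_of_mem fun i _ => mem_univ _, card_univ,
      Fintype.card_fin]
  obtain ⟨z, hz⟩ := exists_card_filter_eq (fun b : X × Y => k b.1 b.2) hsum
  refine ⟨empDist z, ⟨z, mem_typeClass.2 rfl⟩, funext fun x => ?_,
    fun b hb => by simp [empDist, hz, h0 b.1 b.2 hb], fun b => ?_⟩
  · simp only [margFst, empDist, hz, ← sum_div, ← hk, Nat.cast_sum]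
  · have hN := hle b.1 b.2
    rw [← hz b, ← natCast_mul_empDist, ← natCast_mul_empDist, mul_assoc, ← mul_sub, abs_mul,
      Nat.abs_cast] at hN
    exact hN

end Approximation

/-! ### Averages over random codes -/

section RandomMaps

variable {A B T : Type*} [Fintype A] [DecidableEq A] [Fintype B] [Nonempty B]

theorem expect_eq_expect_update (H : (A → B) → ℝ) (u : A) :
    𝔼 f, H f = 𝔼 f, 𝔼 b, H (Function.update f u b) := by
  -- Exchanging `b` with the value `f u` is a measure-preserving involution.
  have hinv : Function.Involutive fun z : (A → B) × B => (Function.update z.1 u z.2, z.1 u) :=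
    fun z => by simp
  calc 𝔼 f, H f = 𝔼 z : (A → B) × B, H z.1 := by
        rw [← univ_product_univ, expect_product]
        simp only [Fintype.expect_const]
    _ = 𝔼 z : (A → B) × B, H (Function.update z.1 u z.2) :=
        (Fintype.expect_equiv hinv.toPerm _ _ fun z => rfl).symm
    _ = 𝔼 f, 𝔼 b, H (Function.update f u b) := by rw [← univ_product_univ, expect_product]

theorem expect_apply (h : B → ℝ) (u : A) : 𝔼 f : A → B, h (f u) = 𝔼 b, h b := by
  rw [expect_eq_expect_update _ u]
  simp only [Function.update_self, Fintype.expect_const]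

theorem expect_apply_apply (h : B → B → ℝ) {u u' : A} (hu : u ≠ u') :
    𝔼 f : A → B, h (f u) (f u') = 𝔼 b, 𝔼 b', h b b' := by
  rw [expect_eq_expect_update _ u]
  simp only [Function.update_self, Function.update_of_ne hu.symm]
  rw [expect_comm]
  exact expect_congr rfl fun b _ => expect_apply (h b) u'

theorem expect_update_apply [Fintype T] [Nonempty T] (x₀ : T) (ψ : T → ℝ) (i j : A) :
    𝔼 C : A → T, ψ (Function.update C i x₀ j) = if j = i then ψ x₀ else 𝔼 x, ψ x := by
  split_ifs with h
  · simp only [h, Function.update_self, Fintype.expect_const]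
  · simp only [Function.update_of_ne h, expect_apply]

theorem expect_update_apply_mul [Fintype T] [Nonempty T] (x₀ : T) (φ ψ : T → ℝ) (i : A) {j k : A}
    (hjk : j ≠ k) :
    𝔼 C : A → T, φ (Function.update C i x₀ j) * ψ (Function.update C i x₀ k) =
      (if j = i then φ x₀ else 𝔼 x, φ x) * if k = i then ψ x₀ else 𝔼 x, ψ x := by
  by_cases hj : j = i
  · simp only [hj, Function.update_self, if_true, ← mul_expect, expect_update_apply]
  by_cases hk : k = i
  · simp only [hk, Function.update_self, if_true, ← expect_mul, expect_update_apply]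
  simp only [Function.update_of_ne hj, Function.update_of_ne hk, if_neg hj, if_neg hk,
    expect_apply_apply (fun x x' => φ x * ψ x') hjk, ← mul_expect, ← expect_mul]

theorem expect_ite_eq_const [DecidableEq B] (i : B) (c d : ℝ) :
    𝔼 j, (if j = i then c else d) = d + (c - d) / Fintype.card B := by
  have h : ∀ j, (if j = i then c else d) = d + if j = i then c - d else 0 := fun j => by
    split_ifs <;> ring
  simp only [h]
  rw [expect_add_distrib, Fintype.expect_const, Fintype.expect_eq_sum_div_card, sum_ite_eq',
    if_pos (mem_univ i)]

theorem expect_ite_mem_eq_card_div [Fintype T] [DecidableEq T] (S : Finset T) :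
    𝔼 x, (if x ∈ S then 1 else 0 : ℝ) = #S / Fintype.card T := by
  rw [Fintype.expect_eq_sum_div_card, sum_boole, filter_mem_eq_inter, univ_inter]

theorem expect_ite_update_mem_mul_le [Fintype T] [Nonempty T] [DecidableEq T] {x₀ : T}
    {S : Finset T} (hx₀ : x₀ ∈ S) (i j k : A) :
    𝔼 C : A → T, ((if Function.update C i x₀ j ∈ S then 1 else 0) *
      if Function.update C i x₀ k ∈ S then 1 else 0 : ℝ) ≤
      (if j = i then 1 else (#S : ℝ) / Fintype.card T) *
          (if k = i then 1 else (#S : ℝ) / Fintype.card T) +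
        (if j = i then 1 else (#S : ℝ) / Fintype.card T) * if k = j then 1 else 0 := by
  by_cases h : k = j
  · subst h
    simp only [ite_mul_ite, mul_one, mul_zero, if_true]
    rw [expect_update_apply x₀ (fun x => if x ∈ S then (1 : ℝ) else 0),
      expect_ite_mem_eq_card_div, if_pos hx₀]
    exact le_add_of_nonneg_left (by positivity)
  · rw [expect_update_apply_mul x₀ (fun x => if x ∈ S then (1 : ℝ) else 0)
      (fun x => if x ∈ S then (1 : ℝ) else 0) i (Ne.symm h), expect_ite_mem_eq_card_div,
      if_pos hx₀, if_neg h, mul_zero, add_zero]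

end RandomMaps

section SecondMoment

variable {Ω ι : Type*} [Fintype Ω] (N : Finset ι) (E : ι → Ω → Prop)
  [∀ i ω, Decidable (E i ω)]

theorem expect_sq_sum_ite_le {a b : ℝ} (hb : 0 ≤ b)
    (h₁ : ∀ i ∈ N, 𝔼 ω, (if E i ω then 1 else 0 : ℝ) = a)
    (h₂ : ∀ i ∈ N, ∀ j ∈ N, i ≠ j →
      𝔼 ω, ((if E i ω then 1 else 0) * if E j ω then 1 else 0 : ℝ) ≤ b) :
    𝔼 ω, (∑ i ∈ N, if E i ω then 1 else 0 : ℝ) ^ 2 ≤ #N * a + (#N : ℝ) ^ 2 * b := by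
  classical
  have hpair : ∀ i ∈ N, ∀ j ∈ N,
      𝔼 ω, ((if E i ω then 1 else 0) * if E j ω then 1 else 0 : ℝ) ≤
        b + if j = i then a else 0 := by
    intro i hi j hj
    by_cases h : j = i
    · subst h
      rw [if_pos rfl, ← h₁ j hi]
      simp only [ite_mul_ite, mul_one, mul_zero]
      simpa using hb
    · simpa only [if_neg h, add_zero] using h₂ i hi j hj (Ne.symm h)
  calc 𝔼 ω, (∑ i ∈ N, if E i ω then 1 else 0 : ℝ) ^ 2
      = ∑ i ∈ N, ∑ j ∈ N, 𝔼 ω, ((if E i ω then 1 else 0) * if E j ω then 1 else 0 : ℝ) := by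
        simp only [sq, sum_mul_sum, expect_sum_comm]
    _ ≤ ∑ i ∈ N, ∑ j ∈ N, (b + if j = i then a else 0) :=
        sum_le_sum fun i hi => sum_le_sum fun j hj => hpair i hi j hj
    _ = ∑ _ ∈ N, (#N * b + a) := sum_congr rfl fun _ hi => by
        rw [sum_add_distrib, sum_const, nsmul_eq_mul, sum_ite_eq', if_pos hi]
    _ = #N * a + (#N : ℝ) ^ 2 * b := by rw [sum_const, nsmul_eq_mul]; ring

theorem min_one_card_mul_div_three_le_expect {a : ℝ} (ha : 0 ≤ a)
    (h₁ : ∀ i ∈ N, 𝔼 ω, (if E i ω then 1 else 0 : ℝ) = a)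
    (h₂ : ∀ i ∈ N, ∀ j ∈ N, i ≠ j →
      𝔼 ω, ((if E i ω then 1 else 0) * if E j ω then 1 else 0 : ℝ) ≤ 2 * a ^ 2) :
    min 1 (#N * a) / 3 ≤ 𝔼 ω, (if ∃ i ∈ N, E i ω then 1 else 0 : ℝ) := by
  set m : ℝ := #N * a with hm
  have hm0 : 0 ≤ m := by positivity
  set L : Ω → ℝ := fun ω => ∑ i ∈ N, if E i ω then 1 else 0
  have hL : 𝔼 ω, L ω = m := by
    rw [expect_sum_comm, sum_congr rfl h₁, sum_const, nsmul_eq_mul]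
  have hL2 : 𝔼 ω, L ω ^ 2 ≤ m + 2 * m ^ 2 :=
    (expect_sq_sum_ite_le N E (by positivity) h₁ h₂).trans_eq (by rw [hm]; ring)
  -- `2lL - (lL)² ≤ 1` vanishes with `L`; this value of `l` maximizes the resulting bound.
  set l : ℝ := 1 / (1 + 2 * m) with hl
  have hpoint : ∀ ω, 2 * l * L ω - l ^ 2 * L ω ^ 2 ≤ if ∃ i ∈ N, E i ω then 1 else 0 := by
    intro ω
    split_ifs with h
    · linarith [sq_nonneg (l * L ω - 1)]
    · have hzero : L ω = 0 := sum_eq_zero fun i hi => if_neg fun hE => h ⟨i, hi, hE⟩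
      simp [hzero]
  calc min 1 m / 3 ≤ m / (1 + 2 * m) := by
        rw [div_le_div_iff₀ three_pos (by positivity)]
        rcases le_total 1 m with h | h
        · rw [min_eq_left h]; linarith
        · rw [min_eq_right h]; nlinarith
    _ = 2 * l * m - l ^ 2 * (m + 2 * m ^ 2) := by rw [hl]; field_simp; ring
    _ ≤ 2 * l * (𝔼 ω, L ω) - l ^ 2 * 𝔼 ω, L ω ^ 2 := by rw [hL]; gcongr
    _ = 𝔼 ω, (2 * l * L ω - l ^ 2 * L ω ^ 2) := by
        rw [expect_sub_distrib, mul_expect, mul_expect]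
    _ ≤ 𝔼 ω, (if ∃ i ∈ N, E i ω then 1 else 0 : ℝ) := expect_le_expect fun ω _ => hpoint ω

end SecondMoment

/-- The probability that the codeword of a source word falls into a set of codewords that has
relative size `q` and contains the codeword of another source word: they share one of `M` bins
with probability `1 / M`, and otherwise their codewords are independent. -/
def collisionProb (M : ℕ) (q : ℝ) : ℝ := q + (1 - q) / M

theorem le_collisionProb {M : ℕ} {q : ℝ} (hq : q ≤ 1) : q ≤ collisionProb M q :=
  le_add_of_nonneg_right (div_nonneg (sub_nonneg.2 hq) M.cast_nonneg)

theorem one_div_le_collisionProb {M : ℕ} (hM : 0 < M) {q : ℝ} (hq : 0 ≤ q) :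
    1 / (M : ℝ) ≤ collisionProb M q := by
  have hM1 : 1 / (M : ℝ) ≤ 1 := (div_le_one (by positivity)).2 (by exact_mod_cast hM)
  calc 1 / (M : ℝ) ≤ 1 / M + q * (1 - 1 / M) :=
        le_add_of_nonneg_right (mul_nonneg hq (sub_nonneg.2 hM1))
    _ = collisionProb M q := by unfold collisionProb; ring

section RandomCode

variable {A B T : Type*} [Fintype A] [DecidableEq A] [Fintype B] [DecidableEq B] [Nonempty B]
  [Fintype T] [Nonempty T]

/-- The codewords of all source words under a random code conditioned on `u` receiving the codeword
`x₀`, realized by putting `u` into a fresh random bin, whose codeword is set to `x₀`. -/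
def conditionedCode (u : A) (x₀ : T) (ω : B × (A → B) × (B → T)) (u' : A) : T :=
  Function.update ω.2.2 ω.1 x₀ (Function.update ω.2.1 u ω.1 u')

theorem expect_conditionedCode_apply {u u' : A} (hu : u' ≠ u) (x₀ : T) (ψ : T → ℝ) :
    𝔼 ω : B × (A → B) × (B → T), ψ (conditionedCode u x₀ ω u') =
      (𝔼 x, ψ x) + (ψ x₀ - 𝔼 x, ψ x) / Fintype.card B := by
  simp only [← univ_product_univ, expect_product, conditionedCode, Function.update_of_ne hu,
    expect_update_apply]
  have hbin : ∀ i : B, 𝔼 f : A → B, (if f u' = i then ψ x₀ else 𝔼 x, ψ x) =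
      (𝔼 x, ψ x) + (ψ x₀ - 𝔼 x, ψ x) / Fintype.card B := fun i => by
    rw [expect_apply (fun j => if j = i then ψ x₀ else 𝔼 x, ψ x), expect_ite_eq_const]
  simp only [Fintype.expect_const, hbin]

variable [DecidableEq T]

theorem expect_ite_code_eq_mul (u : A) (x₀ : T) (Φ : (A → T) → ℝ) :
    𝔼 f : A → B, 𝔼 C : B → T, (if C (f u) = x₀ then 1 else 0) * Φ (fun u' => C (f u')) =
      (1 / Fintype.card T) *
        𝔼 ω : B × (A → B) × (B → T), Φ (conditionedCode u x₀ ω) := by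
  have hcodebook : ∀ (f : A → B) (i : B),
      𝔼 C : B → T, (if C i = x₀ then 1 else 0) * Φ (fun u' => C (f u')) =
        𝔼 C : B → T, (1 / Fintype.card T) * Φ fun u' => Function.update C i x₀ (f u') := by
    intro f i
    rw [expect_eq_expect_update _ i]
    refine expect_congr rfl fun C _ => ?_
    simp only [Function.update_self, Fintype.expect_eq_sum_div_card, ite_mul, one_mul, zero_mul,
      sum_ite_eq', mem_univ, if_true]
    rw [div_eq_mul_one_div, mul_comm]
  rw [expect_eq_expect_update _ u, expect_comm]
  simp only [← univ_product_univ, expect_product, Function.update_self, hcodebook, mul_expect]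
  rfl

theorem expect_ite_conditionedCode_mem {u u' : A} (hu : u' ≠ u) {x₀ : T} {S : Finset T}
    (hx₀ : x₀ ∈ S) :
    𝔼 ω : B × (A → B) × (B → T), (if conditionedCode u x₀ ω u' ∈ S then 1 else 0 : ℝ) =
      collisionProb (Fintype.card B) (#S / Fintype.card T) := by
  rw [expect_conditionedCode_apply hu x₀ fun x => if x ∈ S then (1 : ℝ) else 0,
    expect_ite_mem_eq_card_div, if_pos hx₀, collisionProb]

theorem expect_ite_conditionedCode_mem_mul_le {u u' u'' : A} (hu' : u' ≠ u) (hu'' : u'' ≠ u)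
    (hne : u' ≠ u'') {x₀ : T} {S : Finset T} (hx₀ : x₀ ∈ S) :
    𝔼 ω : B × (A → B) × (B → T), ((if conditionedCode u x₀ ω u' ∈ S then 1 else 0) *
      if conditionedCode u x₀ ω u'' ∈ S then 1 else 0 : ℝ) ≤
      2 * collisionProb (Fintype.card B) (#S / Fintype.card T) ^ 2 := by
  set q : ℝ := #S / Fintype.card T with hq
  have hq0 : 0 ≤ q := by positivity
  have hB : 1 / (Fintype.card B : ℝ) ≤ collisionProb (Fintype.card B) q :=
    one_div_le_collisionProb Fintype.card_pos hq0
  have hpos : 0 ≤ collisionProb (Fintype.card B) q := le_trans (by positivity) hB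
  set r : B → B → ℝ := fun i j => if j = i then 1 else q
  have hsum : ∀ i, 𝔼 j, r i j = collisionProb (Fintype.card B) q := fun i =>
    expect_ite_eq_const i 1 q
  simp only [← univ_product_univ, expect_product, conditionedCode, Function.update_of_ne hu',
    Function.update_of_ne hu'']
  -- The bins of `u'` and `u''` are independent and uniform.
  calc _ = 𝔼 i : B, 𝔼 j, 𝔼 k, 𝔼 C : B → T, ((if Function.update C i x₀ j ∈ S then 1 else 0) *
          if Function.update C i x₀ k ∈ S then 1 else 0 : ℝ) :=
        expect_congr rfl fun i _ => expect_apply_apply (fun j k => 𝔼 C : B → T,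
          ((if Function.update C i x₀ j ∈ S then 1 else 0) *
            if Function.update C i x₀ k ∈ S then 1 else 0 : ℝ)) hne
    _ ≤ 𝔼 i : B, 𝔼 j, 𝔼 k, (r i j * r i k + r i j * if k = j then 1 else 0) :=
        expect_le_expect fun i _ => expect_le_expect fun j _ => expect_le_expect fun k _ =>
          expect_ite_update_mem_mul_le hx₀ i j k
    _ = collisionProb (Fintype.card B) q ^ 2 +
          collisionProb (Fintype.card B) q * (1 / Fintype.card B) := by
        simp only [expect_add_distrib, ← mul_expect, ← expect_mul, hsum, expect_ite_eq_const,
          Fintype.expect_const, sub_zero, zero_add, sq]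
    _ ≤ 2 * collisionProb (Fintype.card B) q ^ 2 := by nlinarith

theorem le_expect_exists_code_mem {x₀ : T} {S : Finset T} (hx₀ : x₀ ∈ S) {u : A} {N : Finset A}
    (hu : u ∉ N) :
    (1 / Fintype.card T) *
        (min 1 (#N * collisionProb (Fintype.card B) (#S / Fintype.card T)) / 3) ≤
      𝔼 f : A → B, 𝔼 C : B → T, (if C (f u) = x₀ then 1 else 0) *
        (if ∃ u' ∈ N, C (f u') ∈ S then 1 else 0 : ℝ) := by
  have hne : ∀ u' ∈ N, u' ≠ u := fun u' hu' h => hu (h ▸ hu')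
  have hcoll : 0 ≤ collisionProb (Fintype.card B) ((#S : ℝ) / Fintype.card T) :=
    le_trans (by positivity) (one_div_le_collisionProb Fintype.card_pos (by positivity))
  rw [expect_ite_code_eq_mul u x₀ fun g => if ∃ u' ∈ N, g u' ∈ S then (1 : ℝ) else 0]
  gcongr
  exact min_one_card_mul_div_three_le_expect N (fun u' ω => conditionedCode u x₀ ω u' ∈ S) hcoll
    (fun u' hu' => expect_ite_conditionedCode_mem (hne u' hu') hx₀)
    fun u' hu' u'' hu'' h =>
      expect_ite_conditionedCode_mem_mul_le (hne u' hu') (hne u'' hu'') h hx₀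

theorem expect_exists_code_mem_le (x₀ : T) (S : A → Finset T) (u : A) :
    𝔼 f : A → B, 𝔼 C : B → T, (if C (f u) = x₀ then 1 else 0) *
        (if ∃ u', u' ≠ u ∧ C (f u') ∈ S u' then 1 else 0 : ℝ) ≤
      (1 / Fintype.card T) * min 1 (∑ u', ((#(S u') : ℝ) / Fintype.card T +
        (if x₀ ∈ S u' then 1 else 0) / Fintype.card B)) := by
  rw [expect_ite_code_eq_mul u x₀ fun g => if ∃ u', u' ≠ u ∧ g u' ∈ S u' then (1 : ℝ) else 0]
  gcongr
  have hterm : ∀ u', (0 : ℝ) ≤ (#(S u') : ℝ) / Fintype.card T +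
      (if x₀ ∈ S u' then 1 else 0) / Fintype.card B := fun u' => by split_ifs <;> positivity
  refine le_min ?_ ?_
  · refine (expect_le_expect fun ω _ => ?_).trans_eq (Fintype.expect_const 1)
    split_ifs <;> norm_num
  calc _ ≤ 𝔼 ω : B × (A → B) × (B → T), ∑ u' ∈ univ.erase u,
        (if conditionedCode u x₀ ω u' ∈ S u' then 1 else 0 : ℝ) := by
        refine expect_le_expect fun ω _ => ?_
        have hnonneg : ∀ u' ∈ univ.erase u,
            (0 : ℝ) ≤ if conditionedCode u x₀ ω u' ∈ S u' then 1 else 0 :=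
          fun u' _ => by split_ifs <;> norm_num
        split_ifs with h
        · obtain ⟨u', hu', hS⟩ := h
          exact (if_pos hS).ge.trans
            (single_le_sum hnonneg (mem_erase.2 ⟨hu', mem_univ u'⟩))
        · exact sum_nonneg hnonneg
    _ ≤ ∑ u' ∈ univ.erase u, ((#(S u') : ℝ) / Fintype.card T +
          (if x₀ ∈ S u' then 1 else 0) / Fintype.card B) := by
        rw [expect_sum_comm]
        refine sum_le_sum fun u' hu' => ?_
        rw [expect_conditionedCode_apply (ne_of_mem_erase hu') x₀
          fun x => if x ∈ S u' then (1 : ℝ) else 0, expect_ite_mem_eq_card_div]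
        gcongr
        exact sub_le_self _ (by positivity)
    _ ≤ _ := sum_le_sum_of_subset_of_nonneg (erase_subset _ _) fun u' _ _ => hterm u'

end RandomCode

/-! ### The exponent in terms of joint types -/

section JointObjective

variable {U V X Y : Type*} [Fintype U] [Fintype V] [Fintype X] [Fintype Y]

/-- The functional `exponentObjective` in terms of the pair `z` of the joint distribution of the
source pair and the joint distribution `J = z.2` of channel input and output. Both divergences are
written as a cross entropy minus an entropy, which makes the functional real-valued and continuous;
it has the intended meaning on `feasiblePairs P W`. -/
def jointObjective (P : U × V → ℝ) (W : X → Y → ℝ) (R : ℝ) (z : (U × V → ℝ) × (X × Y → ℝ)) : ℝ :=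
  (crossEntropy z.1 P - entropy z.1) +
    (crossEntropy z.2 (Function.uncurry W) - (entropy z.2 - entropy (margFst z.2))) +
    max 0 (min R (mutualInfo z.2) - condEntropy z.1)

/-- The pairs of joint distributions at which both divergences are finite. -/
def feasiblePairs (P : U × V → ℝ) (W : X → Y → ℝ) : Set ((U × V → ℝ) × (X × Y → ℝ)) :=
  {z | (z.1 ∈ stdSimplex ℝ (U × V) ∧ IsDominatedBy z.1 P) ∧
    z.2 ∈ stdSimplex ℝ (X × Y) ∧ IsDominatedBy z.2 (Function.uncurry W)}

/-- The values of `jointObjective` at the feasible pairs with channel input distribution `Q`; their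
minimum is the exponent at `Q`. -/
def jointValues (P : U × V → ℝ) (W : X → Y → ℝ) (Q : X → ℝ) (R : ℝ) : Set ℝ :=
  jointObjective P W R '' {z ∈ feasiblePairs P W | margFst z.2 = Q}

end JointObjective

section NumBins

theorem numBins_pos (R : ℝ) (n : ℕ) : 0 < numBins R n :=
  Nat.ceil_pos.2 (by positivity)

theorem one_div_numBins_le (R : ℝ) (n : ℕ) : 1 / (numBins R n : ℝ) ≤ 2 ^ (-(n * R)) := by
  rw [Real.rpow_neg zero_le_two, one_div]
  exact inv_anti₀ (by positivity) (Nat.le_ceil _)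

theorem two_rpow_neg_le_two_mul_one_div_numBins {R : ℝ} (hR : 0 ≤ R) (n : ℕ) :
    (2 : ℝ) ^ (-(n * R)) ≤ 2 * (1 / (numBins R n : ℝ)) := by
  have hpos : (0 : ℝ) < numBins R n := by exact_mod_cast numBins_pos R n
  have hceil : (numBins R n : ℝ) ≤ 2 * 2 ^ (n * R) :=
    Nat.ceil_le_two_mul ((by norm_num : (2⁻¹ : ℝ) ≤ 1).trans
      (Real.one_le_rpow one_le_two (by positivity)))
  rw [Real.rpow_neg zero_le_two, mul_one_div, inv_le_comm₀ (by positivity) (by positivity),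
    inv_div]
  linarith

end NumBins

/-! ### Achievability -/

section ErrorProb

variable {U V X Y : Type*} [Fintype U] [Fintype V] [Fintype X] [Fintype Y] [DecidableEq U]
  [DecidableEq X] {n M : ℕ} {Q : X → ℝ} {P : U × V → ℝ} {W : X → Y → ℝ}

theorem errorProb_eq_expect (P : U × V → ℝ) (W : X → Y → ℝ) (δ : Decoder U V Y n M Q) :
    errorProb P W δ = 𝔼 f : Binning U n M, 𝔼 C : Codebook n M Q,
      ∑ v, ∑ y, ∑ u, if δ f C v y ≠ u then mapMetric P W u v (C (f u)) y else 0 := by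
  simp only [Fintype.expect_eq_sum_div_card]
  rw [errorProb, ← sum_div, div_div, mul_comm]
  congr 1
  refine sum_congr rfl fun f _ => sum_congr rfl fun C _ => ?_
  rw [sum_comm]
  refine sum_congr rfl fun v _ => ?_
  rw [sum_comm]
  rfl

theorem errorProb_map_le {δ δ' : Decoder U V Y n M Q} (hδ : IsArgmaxDecoder (mapMetric P W) δ) :
    errorProb P W δ ≤ errorProb P W δ' := by
  have herr : ∀ (f : Binning U n M) (C : Codebook n M Q) v y (d : Fin n → U),
      (∑ u, if d ≠ u then mapMetric P W u v (C (f u)) y else 0) =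
        (∑ u, mapMetric P W u v (C (f u)) y) - mapMetric P W d v (C (f d)) y := by
    intro f C v y d
    rw [← sum_filter, filter_ne, sum_erase_eq_sub (mem_univ d)]
  simp only [errorProb_eq_expect, herr]
  exact expect_le_expect fun f _ => expect_le_expect fun C _ => sum_le_sum fun v _ =>
    sum_le_sum fun y _ => sub_le_sub_left (hδ f C v y (δ' f C v y)) _

theorem mapMetric_nonneg {U V X Y : Type*} {P : U × V → ℝ} (hP : 0 ≤ P) {W : X → Y → ℝ}
    (hW : 0 ≤ W) (u : Fin n → U) (v : Fin n → V) (x : Fin n → X) (y : Fin n → Y) :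
    0 ≤ mapMetric P W u v x y :=
  mul_nonneg (prod_nonneg fun _ _ => hP _) (prod_nonneg fun _ _ => hW _ _)

/-- The codewords with which the source word `u'` beats the source word `u` with codeword `x₀` under
the decoding metric `m`. Ties count as a win, since an arg-max decoder may break them so. -/
def beatingCodewords (m : (Fin n → U) → (Fin n → V) → (Fin n → X) → (Fin n → Y) → ℝ)
    (v : Fin n → V) (y : Fin n → Y) (u : Fin n → U) (x₀ : ↥(typeClass n Q)) (u' : Fin n → U) :
    Finset ↥(typeClass n Q) :=
  {x | m u v x₀ y ≤ m u' v x y}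

theorem errorProb_le_sum_mul_expect (hP : 0 ≤ P) (hW : 0 ≤ W)
    {m : (Fin n → U) → (Fin n → V) → (Fin n → X) → (Fin n → Y) → ℝ} {δ : Decoder U V Y n M Q}
    (hδ : IsArgmaxDecoder m δ) :
    errorProb P W δ ≤ ∑ v, ∑ y, ∑ u, ∑ x₀ : ↥(typeClass n Q), mapMetric P W u v x₀ y *
      𝔼 f : Binning U n M, 𝔼 C : Codebook n M Q, (if C (f u) = x₀ then 1 else 0) *
        (if ∃ u', u' ≠ u ∧ C (f u') ∈ beatingCodewords m v y u x₀ u' then 1 else 0) := by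
  simp only [mul_expect, ← expect_sum_comm]
  rw [errorProb_eq_expect]
  refine expect_le_expect fun f _ => expect_le_expect fun C _ => sum_le_sum fun v _ =>
    sum_le_sum fun y _ => sum_le_sum fun u _ => ?_
  have hterm : ∀ x₀ : ↥(typeClass n Q), 0 ≤ mapMetric P W u v x₀ y *
      ((if C (f u) = x₀ then 1 else 0) *
        (if ∃ u', u' ≠ u ∧ C (f u') ∈ beatingCodewords m v y u x₀ u' then 1 else 0)) := fun x₀ =>
    mul_nonneg (mapMetric_nonneg hP hW _ _ _ _) (by positivity)
  split_ifs with herr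
  · have hbeat : ∃ u', u' ≠ u ∧ C (f u') ∈ beatingCodewords m v y u (C (f u)) u' :=
      ⟨δ f C v y, herr, mem_filter.2 ⟨mem_univ _, hδ f C v y u⟩⟩
    refine le_trans ?_ (single_le_sum (fun x₀ _ => hterm x₀) (mem_univ (C (f u))))
    rw [if_pos rfl, if_pos hbeat, mul_one, mul_one]
  · exact sum_nonneg fun x₀ _ => hterm x₀

end ErrorProb

section Achievability

variable {U V X Y : Type*} [Fintype U] [Fintype V] [Fintype X] [Fintype Y]
  [DecidableEq U] [DecidableEq V] [DecidableEq X] [DecidableEq Y] {n : ℕ}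

/-- The properties of a decoding metric that make it universal: a source word beating another one
has the larger empirical rate margin, up to clipping at `R`, and the smaller conditional entropy if
the two share their codeword. -/
structure IsUniversalMetric (R : ℝ)
    (m : (Fin n → U) → (Fin n → V) → (Fin n → X) → (Fin n → Y) → ℝ) : Prop where
  gmmiMetric'_le_gmmiMetric : ∀ {u u' v x x' y}, m u v x y ≤ m u' v x' y →
    gmmiMetric' R u v x y ≤ gmmiMetric u' v x' y
  condEntropy_le : ∀ {u u' v x y}, m u v x y ≤ m u' v x y →
    condEntropy (empJoint u' v) ≤ condEntropy (empJoint u v)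

theorem isUniversalMetric_gmmiMetric (R : ℝ) :
    IsUniversalMetric R (gmmiMetric (U := U) (V := V) (X := X) (Y := Y) (n := n)) where
  gmmiMetric'_le_gmmiMetric h := (sub_le_sub_right (min_le_right _ _) _).trans h
  condEntropy_le h := (sub_le_sub_iff_left _).1 h

theorem isUniversalMetric_gmmiMetric' (R : ℝ) :
    IsUniversalMetric R (gmmiMetric' (U := U) (V := V) (X := X) (Y := Y) (n := n) R) where
  gmmiMetric'_le_gmmiMetric h := h.trans (sub_le_sub_right (min_le_right _ _) _)
  condEntropy_le h := (sub_le_sub_iff_left _).1 h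

theorem one_div_card_typeClass_le {Q : X → ℝ} (hQ : (typeClass n Q).Nonempty) :
    1 / (#(typeClass n Q) : ℝ) ≤
      ((n : ℝ) + 1) ^ Fintype.card X * 2 ^ (-(n * entropy Q)) := by
  rw [div_le_iff₀ (by exact_mod_cast hQ.card_pos), Real.rpow_neg zero_le_two]
  have hcard := le_card_typeClass hQ
  field_simp
  exact hcard

theorem card_div_card_typeClass_le {Q : X → ℝ} {y : Fin n → Y} {c : ℝ}
    {S : Finset ↥(typeClass n Q)} (hS : ∀ x ∈ S, c ≤ mutualInfo (empJoint x.1 y)) :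
    (#S : ℝ) / #(typeClass n Q) ≤
      ((n : ℝ) + 1) ^ (Fintype.card (X × Y) + Fintype.card Y + Fintype.card X) *
        2 ^ (-(n * c)) := by
  rcases S.eq_empty_or_nonempty with rfl | ⟨x, hx⟩
  · rw [card_empty, Nat.cast_zero, zero_div]; positivity
  have hsingle : ∀ x ∈ S,
      (1 : ℝ) ≤ 2 ^ (n * (entropy Q - c)) * 2 ^ (-(n * condEntropy (empJoint x.1 y))) := by
    intro x hx
    have hI := hS x hx
    rw [mutualInfo_eq_sub, margFst_empJoint, mem_typeClass.1 x.2] at hI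
    rw [← Real.rpow_add two_pos]
    refine Real.one_le_rpow one_le_two ?_
    have hn : (0 : ℝ) ≤ n * (entropy Q - condEntropy (empJoint x.1 y) - c) :=
      mul_nonneg n.cast_nonneg (sub_nonneg.2 hI)
    linarith
  have hS' : (#S : ℝ) ≤ 2 ^ (n * (entropy Q - c)) *
      ((n : ℝ) + 1) ^ (Fintype.card (X × Y) + Fintype.card Y) := by
    calc (#S : ℝ) ≤ ∑ x ∈ S,
          2 ^ (n * (entropy Q - c)) * 2 ^ (-(n * condEntropy (empJoint x.1 y))) := by
          simpa only [nsmul_one] using card_nsmul_le_sum S _ 1 hsingle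
      _ = 2 ^ (n * (entropy Q - c)) *
          ∑ x ∈ S.map (.subtype _), 2 ^ (-(n * condEntropy (empJoint x y))) := by
        rw [← mul_sum, sum_map]; rfl
      _ ≤ 2 ^ (n * (entropy Q - c)) * ∑ x : Fin n → X, 2 ^ (-(n * condEntropy (empJoint x y))) := by
        gcongr; exact subset_univ _
      _ ≤ _ := by gcongr; exact sum_two_rpow_condEntropy_le X y
  calc (#S : ℝ) / #(typeClass n Q) = #S * (1 / #(typeClass n Q)) := div_eq_mul_one_div _ _
    _ ≤ 2 ^ (n * (entropy Q - c)) * ((n : ℝ) + 1) ^ (Fintype.card (X × Y) + Fintype.card Y) *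
          (((n : ℝ) + 1) ^ Fintype.card X * 2 ^ (-(n * entropy Q))) := by
        gcongr; exact one_div_card_typeClass_le ⟨x, x.2⟩
    _ = ((n : ℝ) + 1) ^ (Fintype.card (X × Y) + Fintype.card Y + Fintype.card X) *
          (2 ^ (n * (entropy Q - c)) * 2 ^ (-(n * entropy Q))) := by rw [pow_add _ _ (_ : ℕ)]; ring
    _ = _ := by rw [← Real.rpow_add two_pos]; ring_nf

theorem sum_card_beatingCodewords_div_add_le {R : ℝ}
    {m : (Fin n → U) → (Fin n → V) → (Fin n → X) → (Fin n → Y) → ℝ} (hm : IsUniversalMetric R m)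
    {Q : X → ℝ} (u : Fin n → U) (v : Fin n → V) (x₀ : ↥(typeClass n Q)) (y : Fin n → Y) :
    ∑ u', ((#(beatingCodewords m v y u x₀ u') : ℝ) / #(typeClass n Q) +
        (if x₀ ∈ beatingCodewords m v y u x₀ u' then 1 else 0) / (numBins R n : ℝ)) ≤
      2 * ((n : ℝ) + 1) ^ (Fintype.card (X × Y) + Fintype.card Y + Fintype.card X +
        (Fintype.card (U × V) + Fintype.card V)) * 2 ^ (-(n * gmmiMetric' R u v x₀.1 y)) := by
  set c := gmmiMetric' R u v x₀.1 y
  set d := Fintype.card (X × Y) + Fintype.card Y + Fintype.card X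
  have hpow : (1 : ℝ) ≤ ((n : ℝ) + 1) ^ d := one_le_pow₀ (by linarith [n.cast_nonneg (α := ℝ)])
  have hfresh : ∀ u', (#(beatingCodewords m v y u x₀ u') : ℝ) / #(typeClass n Q) ≤
      ((n : ℝ) + 1) ^ d * 2 ^ (-(n * (c + condEntropy (empJoint u' v)))) := fun u' =>
    card_div_card_typeClass_le fun x hx =>
      le_sub_iff_add_le.1 (hm.gmmiMetric'_le_gmmiMetric (mem_filter.1 hx).2)
  have hshared : ∀ u', (if x₀ ∈ beatingCodewords m v y u x₀ u' then 1 else 0) /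
      (numBins R n : ℝ) ≤ ((n : ℝ) + 1) ^ d * 2 ^ (-(n * (c + condEntropy (empJoint u' v)))) := by
    intro u'
    split_ifs with h
    · refine (one_div_numBins_le R n).trans ?_
      refine le_trans ?_ (le_mul_of_one_le_left (by positivity) hpow)
      have hH := hm.condEntropy_le (mem_filter.1 h).2
      have hR : c ≤ R - condEntropy (empJoint u v) := sub_le_sub_right (min_le_left _ _) _
      gcongr
      · exact one_le_two
      · linarith
    · rw [zero_div]; positivity
  calc _ ≤ ∑ u', 2 * ((n : ℝ) + 1) ^ d * 2 ^ (-(n * c)) *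
        2 ^ (-(n * condEntropy (empJoint u' v))) := by
        refine sum_le_sum fun u' _ => (add_le_add (hfresh u') (hshared u')).trans_eq ?_
        rw [mul_add, neg_add, Real.rpow_add two_pos]
        ring
    _ ≤ 2 * ((n : ℝ) + 1) ^ d * 2 ^ (-(n * c)) *
          ((n : ℝ) + 1) ^ (Fintype.card (U × V) + Fintype.card V) := by
        rw [← mul_sum]; gcongr; exact sum_two_rpow_condEntropy_le U v
    _ = _ := by rw [pow_add _ d]; ring

theorem min_one_mul_two_rpow_le {K : ℝ} (hK : 1 ≤ K) (n : ℕ) (c : ℝ) :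
    min 1 (K * 2 ^ (-(n * c))) ≤ K * 2 ^ (-(n * max 0 c)) := by
  rcases le_total 0 c with h | h
  · rw [max_eq_right h]; exact min_le_right _ _
  · rw [max_eq_left h]; simpa using Or.inl hK

theorem expect_exists_beatingCodewords_le {R : ℝ}
    {m : (Fin n → U) → (Fin n → V) → (Fin n → X) → (Fin n → Y) → ℝ} (hm : IsUniversalMetric R m)
    {Q : X → ℝ} (u : Fin n → U) (v : Fin n → V) (x₀ : ↥(typeClass n Q)) (y : Fin n → Y) :
    𝔼 f : Binning U n (numBins R n), 𝔼 C : Codebook n (numBins R n) Q,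
      (if C (f u) = x₀ then 1 else 0) *
        (if ∃ u', u' ≠ u ∧ C (f u') ∈ beatingCodewords m v y u x₀ u' then 1 else 0 : ℝ) ≤
      2 * ((n : ℝ) + 1) ^ (Fintype.card X + (Fintype.card (X × Y) + Fintype.card Y +
        Fintype.card X + (Fintype.card (U × V) + Fintype.card V))) *
        (2 ^ (-(n * entropy Q)) * 2 ^ (-(n * max 0 (gmmiMetric' R u v x₀.1 y)))) := by
  have : Nonempty ↥(typeClass n Q) := ⟨x₀⟩
  have : Nonempty (Fin (numBins R n)) := ⟨⟨0, numBins_pos R n⟩⟩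
  have hsum := sum_card_beatingCodewords_div_add_le hm u v x₀ y
  set d := Fintype.card (X × Y) + Fintype.card Y + Fintype.card X +
    (Fintype.card (U × V) + Fintype.card V)
  have hpow : (1 : ℝ) ≤ ((n : ℝ) + 1) ^ d := one_le_pow₀ (by linarith [n.cast_nonneg (α := ℝ)])
  have hunion := expect_exists_code_mem_le (B := Fin (numBins R n)) x₀
    (beatingCodewords m v y u x₀) u
  rw [Fintype.card_coe, Fintype.card_fin] at hunion
  have hmin : min 1 (∑ u', ((#(beatingCodewords m v y u x₀ u') : ℝ) / #(typeClass n Q) +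
        (if x₀ ∈ beatingCodewords m v y u x₀ u' then 1 else 0) / (numBins R n : ℝ))) ≤
      2 * ((n : ℝ) + 1) ^ d * 2 ^ (-(n * max 0 (gmmiMetric' R u v x₀.1 y))) :=
    (min_le_min_left 1 hsum).trans (min_one_mul_two_rpow_le (by linarith) n _)
  refine (hunion.trans (mul_le_mul (one_div_card_typeClass_le ⟨x₀, x₀.2⟩) hmin
    (by positivity) (by positivity))).trans_eq ?_
  rw [pow_add _ (Fintype.card X)]
  ring

theorem mapMetric_eq_two_rpow {P : U × V → ℝ} (hP : 0 ≤ P) {W : X → Y → ℝ} (hW : 0 ≤ W)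
    {u : Fin n → U} {v : Fin n → V} {x : Fin n → X} {y : Fin n → Y}
    (huv : IsDominatedBy (empJoint u v) P)
    (hxy : IsDominatedBy (empJoint x y) (Function.uncurry W)) :
    mapMetric P W u v x y = 2 ^ (-(n * crossEntropy (empJoint u v) P)) *
      2 ^ (-(n * crossEntropy (empJoint x y) (Function.uncurry W))) :=
  have hWuncurry : 0 ≤ Function.uncurry W := fun b => hW b.1 b.2
  congrArg₂ (· * ·) (prod_comp_eq_two_rpow (x := fun i => (u i, v i)) hP huv)
    (prod_comp_eq_two_rpow (x := fun i => (x i, y i)) hWuncurry hxy)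

theorem mapMetric_mul_le {P : U × V → ℝ} (hP : 0 ≤ P) {W : X → Y → ℝ} (hW : 0 ≤ W) {R : ℝ}
    (hn : n ≠ 0) {e : ℝ} {u : Fin n → U} {v : Fin n → V} {x : Fin n → X} {y : Fin n → Y}
    (he : e ∈ lowerBounds (jointValues P W (empDist x) R)) :
    mapMetric P W u v x y *
        (2 ^ (-(n * entropy (empDist x))) * 2 ^ (-(n * max 0 (gmmiMetric' R u v x y)))) ≤
      2 ^ (-(n * e)) *
        (2 ^ (-(n * entropy (empJoint u v))) * 2 ^ (-(n * entropy (empJoint x y)))) := by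
  by_cases hUV : IsDominatedBy (empJoint u v) P
  swap
  · have hzero : mapMetric P W u v x y = 0 :=
      mul_eq_zero_of_left (prod_comp_eq_zero (x := fun i => (u i, v i)) hUV) _
    rw [hzero, zero_mul]; positivity
  by_cases hXY : IsDominatedBy (empJoint x y) (Function.uncurry W)
  swap
  · have hzero : mapMetric P W u v x y = 0 :=
      mul_eq_zero_of_right _ (prod_comp_eq_zero (x := fun i => (x i, y i)) hXY)
    rw [hzero, zero_mul]; positivity
  have hobj : e ≤ jointObjective P W R (empJoint u v, empJoint x y) :=
    he (Set.mem_image_of_mem _ ⟨⟨⟨empDist_mem_stdSimplex hn _, hUV⟩,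
      empDist_mem_stdSimplex hn _, hXY⟩, margFst_empJoint x y⟩)
  rw [mapMetric_eq_two_rpow hP hW hUV hXY]
  simp only [← Real.rpow_add two_pos]
  refine Real.rpow_le_rpow_of_exponent_le one_le_two ?_
  have hmul := mul_le_mul_of_nonneg_left hobj (n.cast_nonneg (α := ℝ))
  simp only [jointObjective, margFst_empJoint] at hmul
  unfold gmmiMetric'
  linarith

theorem errorProb_le {P : U × V → ℝ} (hP : 0 ≤ P) {W : X → Y → ℝ} (hW : 0 ≤ W) {R : ℝ}
    (hn : n ≠ 0) {m : (Fin n → U) → (Fin n → V) → (Fin n → X) → (Fin n → Y) → ℝ}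
    (hm : IsUniversalMetric R m) {Q : X → ℝ} {δ : Decoder U V Y n (numBins R n) Q}
    (hδ : IsArgmaxDecoder m δ) {e : ℝ} (he : e ∈ lowerBounds (jointValues P W Q R)) :
    errorProb P W δ ≤
      2 * ((n : ℝ) + 1) ^ (Fintype.card X + (Fintype.card (X × Y) + Fintype.card Y +
        Fintype.card X + (Fintype.card (U × V) + Fintype.card V)) + Fintype.card (U × V) +
        Fintype.card (X × Y)) * 2 ^ (-(n * e)) := by
  set d := Fintype.card X + (Fintype.card (X × Y) + Fintype.card Y +
    Fintype.card X + (Fintype.card (U × V) + Fintype.card V))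
  calc errorProb P W δ
      ≤ ∑ v, ∑ y, ∑ u, ∑ x₀ : ↥(typeClass n Q), 2 * ((n : ℝ) + 1) ^ d * 2 ^ (-(n * e)) *
          (2 ^ (-(n * entropy (empJoint u v))) * 2 ^ (-(n * entropy (empJoint x₀.1 y)))) := by
        refine (errorProb_le_sum_mul_expect hP hW hδ).trans ?_
        refine sum_le_sum fun v _ => sum_le_sum fun y _ => sum_le_sum fun u _ =>
          sum_le_sum fun x₀ _ => ?_
        have hx₀ : empDist x₀.1 = Q := mem_typeClass.1 x₀.2
        refine (mul_le_mul_of_nonneg_left (expect_exists_beatingCodewords_le hm u v x₀ y)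
          (mapMetric_nonneg hP hW _ _ _ _)).trans ?_
        rw [mul_left_comm, mul_assoc _ (2 ^ (-(n * e)))]
        refine mul_le_mul_of_nonneg_left ?_ (by positivity)
        have hterm := mapMetric_mul_le (u := u) (v := v) (x := x₀.1) (y := y) hP hW hn
          (hx₀.symm ▸ he)
        rwa [hx₀] at hterm
    _ = 2 * ((n : ℝ) + 1) ^ d * 2 ^ (-(n * e)) *
        ((∑ u : Fin n → U, ∑ v : Fin n → V, 2 ^ (-(n * entropy (empJoint u v)))) *
          ∑ x₀ ∈ typeClass n Q, ∑ y : Fin n → Y, 2 ^ (-(n * entropy (empJoint x₀ y)))) := by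
        rw [sum_comm (s := (univ : Finset (Fin n → U))), sum_comm (s := typeClass n Q)]
        simp only [← mul_sum, ← sum_mul]
        simp only [← sum_coe_sort (typeClass n Q)]
    _ ≤ 2 * ((n : ℝ) + 1) ^ d * 2 ^ (-(n * e)) *
        (((n : ℝ) + 1) ^ Fintype.card (U × V) * ((n : ℝ) + 1) ^ Fintype.card (X × Y)) := by
        have hUV := sum_two_rpow_entropy_le (U × V) n
        have hXY := sum_two_rpow_entropy_le (X × Y) n
        rw [← sum_sum_prodMk] at hUV hXY
        gcongr
        · exact hUV
        · exact le_trans (sum_le_univ_sum_of_nonneg fun x => by positivity) hXY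
    _ = _ := by rw [pow_add, pow_add]; ring

end Achievability

/-! ### Converse -/

section Converse

theorem two_rpow_neg_mul_max_le {K m c : ℝ} {n : ℕ} (hK : 1 ≤ K)
    (h : (2 : ℝ) ^ (-(n * c)) ≤ K * m) : (2 : ℝ) ^ (-(n * max 0 c)) ≤ K * min 1 m := by
  rw [mul_min_of_nonneg _ _ (zero_le_one.trans hK), mul_one]
  refine le_min (le_trans ?_ hK) (le_trans ?_ h)
  · exact Real.rpow_le_one_of_one_le_of_nonpos one_le_two
      (neg_nonpos.2 (mul_nonneg n.cast_nonneg (le_max_left _ _)))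
  · gcongr
    · exact one_le_two
    · exact le_max_right _ _

section TypeClasses

variable {A B : Type*} [Fintype A] [Fintype B] [DecidableEq A] [DecidableEq B] {n : ℕ}

theorem two_rpow_condEntropy_le_card_erase {p : A × B → ℝ}
    (hp : 2 * ((n : ℝ) + 1) ^ Fintype.card (A × B) ≤ 2 ^ (n * condEntropy p))
    {u : Fin n → A} {v : Fin n → B} (hu : u ∈ condTypeClass v p) :
    (2 : ℝ) ^ (n * condEntropy p) ≤
      2 * ((n : ℝ) + 1) ^ Fintype.card (A × B) * #((condTypeClass v p).erase u) := by
  have huv := mem_condTypeClass.1 hu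
  have hcard := le_card_condTypeClass (v := v) ⟨_, mem_typeClass.2 huv⟩
    (by rw [← huv, margSnd_empJoint])
  rw [← card_erase_add_one hu, Nat.cast_add, Nat.cast_one, mul_add, mul_one] at hcard
  linarith

theorem two_rpow_neg_mutualInfo_le {J : A × B → ℝ} {x : Fin n → A} {y : Fin n → B}
    (hx : x ∈ condTypeClass y J) :
    (2 : ℝ) ^ (-(n * mutualInfo J)) ≤ ((n : ℝ) + 1) ^ Fintype.card (A × B) *
      ((#(condTypeClass y J) : ℝ) / #(typeClass n (margFst J))) := by
  have hxy := mem_condTypeClass.1 hx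
  have hmem : x ∈ typeClass n (margFst J) := mem_typeClass.2 (by rw [← hxy, margFst_empJoint])
  have hpos : (0 : ℝ) < #(typeClass n (margFst J)) := by exact_mod_cast card_pos.2 ⟨x, hmem⟩
  have hexp : -(n * mutualInfo J) = n * condEntropy J - n * entropy (margFst J) := by
    rw [mutualInfo_eq_sub]; ring
  rw [hexp, Real.rpow_sub two_pos, ← mul_div_assoc]
  exact div_le_div₀ (by positivity)
    (le_card_condTypeClass ⟨_, mem_typeClass.2 hxy⟩ (by rw [← hxy, margSnd_empJoint]))
    hpos (card_typeClass_le n _)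

theorem card_condTypeClass_le_card_typeClass_margFst (y : Fin n → B) (J : A × B → ℝ) :
    #(condTypeClass y J) ≤ #(typeClass n (margFst J)) :=
  card_le_card fun x hx =>
    mem_typeClass.2 (by rw [← mem_condTypeClass.1 hx, margFst_empJoint])

theorem two_rpow_neg_min_mutualInfo_le {R : ℝ} (hR : 0 ≤ R) {J : A × B → ℝ} {x : Fin n → A}
    {y : Fin n → B} (hx : x ∈ condTypeClass y J) :
    (2 : ℝ) ^ (-(n * min R (mutualInfo J))) ≤ 2 * ((n : ℝ) + 1) ^ Fintype.card (A × B) *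
      collisionProb (numBins R n) (#(condTypeClass y J) / #(typeClass n (margFst J))) := by
  set q : ℝ := (#(condTypeClass y J) : ℝ) / #(typeClass n (margFst J)) with hq
  have hq0 : 0 ≤ q := by positivity
  have hq1 : q ≤ 1 := div_le_one_of_le₀
    (by exact_mod_cast card_condTypeClass_le_card_typeClass_margFst y J) (Nat.cast_nonneg _)
  have hpow : (1 : ℝ) ≤ ((n : ℝ) + 1) ^ Fintype.card (A × B) :=
    one_le_pow₀ (by linarith [n.cast_nonneg (α := ℝ)])
  have hcollision : 0 ≤ collisionProb (numBins R n) q := hq0.trans (le_collisionProb hq1)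
  rcases min_choice R (mutualInfo J) with h | h <;> rw [h]
  · calc (2 : ℝ) ^ (-(n * R)) ≤ 2 * (1 / (numBins R n : ℝ)) :=
        two_rpow_neg_le_two_mul_one_div_numBins hR n
      _ ≤ 2 * collisionProb (numBins R n) q := by
        gcongr; exact one_div_le_collisionProb (numBins_pos R n) hq0
      _ ≤ _ := by gcongr; linarith
  · calc (2 : ℝ) ^ (-(n * mutualInfo J)) ≤ ((n : ℝ) + 1) ^ Fintype.card (A × B) * q :=
        two_rpow_neg_mutualInfo_le hx
      _ ≤ ((n : ℝ) + 1) ^ Fintype.card (A × B) * collisionProb (numBins R n) q := by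
        gcongr; exact le_collisionProb hq1
      _ ≤ _ := by gcongr; linarith

end TypeClasses

section EqualLikelihoods

variable {A T : Type*} [DecidableEq A]

theorem card_filter_exists_ne_le (s : Finset A) (d : A) :
    #{u ∈ s | ∃ u' ∈ s, u' ≠ u} ≤ 2 * #(s.erase d) := by
  rcases le_or_gt #s 1 with h | h
  · have hempty : ({u ∈ s | ∃ u' ∈ s, u' ≠ u} : Finset A) = ∅ :=
      filter_eq_empty_iff.2 fun u hu ⟨u', hu', hne⟩ => hne (card_le_one.1 h u' hu' u hu)
    simp [hempty]
  · have hfilter := card_filter_le s fun u => ∃ u' ∈ s, u' ≠ u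
    have herase := pred_card_le_card_erase (s := s) (a := d)
    omega

variable [Fintype A] [DecidableEq T]

/-- Every decision `d` is wrong for at least half of two or more equally likely alternatives. -/
theorem sum_half_mul_exists_le_sum_ite_ne {h : A → T → ℝ} (hh : 0 ≤ h) {w : ℝ} (hw₀ : 0 ≤ w)
    {N : Finset A} {S : Finset T} (hw : ∀ u ∈ N, ∀ x ∈ S, h u x = w) (c : A → T) (d : A) :
    ∑ u ∈ N, ∑ x ∈ S, w / 2 * ((if c u = x then 1 else 0) *
      (if ∃ u' ∈ N.erase u, c u' ∈ S then 1 else 0)) ≤ ∑ u, if d ≠ u then h u (c u) else 0 := by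
  set K : Finset A := {u ∈ N | c u ∈ S} with hK
  have hterm : ∀ u, ∑ x ∈ S, w / 2 * ((if c u = x then 1 else 0) *
      (if ∃ u' ∈ N.erase u, c u' ∈ S then 1 else 0)) =
      if c u ∈ S ∧ ∃ u' ∈ K, u' ≠ u then w / 2 else 0 := by
    intro u
    have hiff : (∃ u' ∈ N.erase u, c u' ∈ S) ↔ ∃ u' ∈ K, u' ≠ u := by
      simp only [hK, mem_erase, mem_filter]; grind
    rw [← mul_sum, ← sum_mul, sum_ite_eq, ite_and]
    simp only [hiff]
    split_ifs <;> simp only [mul_one, mul_zero]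
  have hhalf : (#{u ∈ K | ∃ u' ∈ K, u' ≠ u} : ℝ) ≤ 2 * #(K.erase d) := by
    exact_mod_cast card_filter_exists_ne_le K d
  calc _ = (#{u ∈ K | ∃ u' ∈ K, u' ≠ u} : ℝ) * (w / 2) := by
        rw [sum_congr rfl fun u _ => hterm u, ← sum_filter, sum_const, nsmul_eq_mul,
          ← filter_filter]
    _ ≤ (2 * #(K.erase d) : ℝ) * (w / 2) := by gcongr
    _ = ∑ _u ∈ K.erase d, w := by rw [sum_const, nsmul_eq_mul]; ring
    _ = ∑ u ∈ K.erase d, if d ≠ u then h u (c u) else 0 := by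
        refine sum_congr rfl fun u hu => ?_
        obtain ⟨hne, hu'⟩ := mem_erase.1 hu
        obtain ⟨huN, huS⟩ := mem_filter.1 hu'
        rw [if_pos hne.symm, hw u huN _ huS]
    _ ≤ _ := sum_le_univ_sum_of_nonneg fun u => by split_ifs; exacts [hh u _, le_rfl]

end EqualLikelihoods

variable {U V X Y : Type*} [Fintype U] [Fintype V] [Fintype X] [Fintype Y]
  [DecidableEq U] [DecidableEq V] [DecidableEq X] [DecidableEq Y] {n : ℕ}

theorem sum_half_mul_expect_le_errorProb {P : U × V → ℝ} (hP : 0 ≤ P) {W : X → Y → ℝ}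
    (hW : 0 ≤ W) {M : ℕ} {Q : X → ℝ} {p : U × V → ℝ} {J : X × Y → ℝ} {w : ℝ} (hw₀ : 0 ≤ w)
    (hw : ∀ (u : Fin n → U) (v : Fin n → V) (x : Fin n → X) (y : Fin n → Y),
      empJoint u v = p → empJoint x y = J → mapMetric P W u v x y = w)
    (δ : Decoder U V Y n M Q) :
    ∑ v, ∑ y, ∑ u ∈ condTypeClass v p, ∑ x₀ : ↥(typeClass n Q) with empJoint x₀.1 y = J,
      w / 2 * 𝔼 f : Binning U n M, 𝔼 C : Codebook n M Q, (if C (f u) = x₀ then 1 else 0) *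
        (if ∃ u' ∈ (condTypeClass v p).erase u,
          C (f u') ∈ ({x | empJoint x.1 y = J} : Finset ↥(typeClass n Q)) then 1 else 0) ≤
      errorProb P W δ := by
  simp only [mul_expect, ← expect_sum_comm]
  rw [errorProb_eq_expect]
  refine expect_le_expect fun f _ => expect_le_expect fun C _ => sum_le_sum fun v _ =>
    sum_le_sum fun y _ => ?_
  exact sum_half_mul_exists_le_sum_ite_ne (h := fun u (x : ↥(typeClass n Q)) =>
    mapMetric P W u v x.1 y) (fun u x => mapMetric_nonneg hP hW u v x.1 y) hw₀
    (fun u hu x hx => hw u v x.1 y (mem_condTypeClass.1 hu) (mem_filter.1 hx).2)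
    (fun u => C (f u)) (δ f C v y)

theorem le_expect_exists_code_mem_of_mem_condTypeClass {R : ℝ} (hR : 0 ≤ R) {p : U × V → ℝ}
    (hp : 2 * ((n : ℝ) + 1) ^ Fintype.card (U × V) ≤ 2 ^ (n * condEntropy p))
    {u : Fin n → U} {v : Fin n → V} (hu : u ∈ condTypeClass v p) {J : X × Y → ℝ}
    {x₀ : ↥(typeClass n (margFst J))} {y : Fin n → Y} (hx₀ : empJoint x₀.1 y = J) :
    (2 : ℝ) ^ (-(n * entropy (margFst J))) *
        2 ^ (-(n * max 0 (min R (mutualInfo J) - condEntropy p))) ≤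
      12 * ((n : ℝ) + 1) ^ (Fintype.card (U × V) + Fintype.card (X × Y)) *
        𝔼 f : Binning U n (numBins R n), 𝔼 C : Codebook n (numBins R n) (margFst J),
          (if C (f u) = x₀ then 1 else 0) * (if ∃ u' ∈ (condTypeClass v p).erase u,
            C (f u') ∈ ({x | empJoint x.1 y = J} : Finset ↥(typeClass n (margFst J)))
              then 1 else 0) := by
  have : Nonempty ↥(typeClass n (margFst J)) := ⟨x₀⟩
  have : Nonempty (Fin (numBins R n)) := ⟨⟨0, numBins_pos R n⟩⟩
  have hexpect := le_expect_exists_code_mem (B := Fin (numBins R n))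
    (S := {x : ↥(typeClass n (margFst J)) | empJoint x.1 y = J})
    (mem_filter.2 ⟨mem_univ x₀, hx₀⟩) (notMem_erase u (condTypeClass v p))
  rw [Fintype.card_coe, Fintype.card_fin, card_filter_empJoint_eq rfl] at hexpect
  set N := (condTypeClass v p).erase u
  set q : ℝ := collisionProb (numBins R n) (#(condTypeClass y J) / #(typeClass n (margFst J)))
  set d := Fintype.card (U × V) + Fintype.card (X × Y) with hd
  have hpow : (1 : ℝ) ≤ ((n : ℝ) + 1) ^ d := one_le_pow₀ (by linarith [n.cast_nonneg (α := ℝ)])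
  have hcollisions : (2 : ℝ) ^ (-(n * (min R (mutualInfo J) - condEntropy p))) ≤
      4 * ((n : ℝ) + 1) ^ d * (#N * q) := by
    calc (2 : ℝ) ^ (-(n * (min R (mutualInfo J) - condEntropy p))) =
        2 ^ (n * condEntropy p) * 2 ^ (-(n * min R (mutualInfo J))) := by
          rw [← Real.rpow_add two_pos]; ring_nf
      _ ≤ _ := mul_le_mul (two_rpow_condEntropy_le_card_erase hp hu)
          (two_rpow_neg_min_mutualInfo_le hR (mem_condTypeClass.2 hx₀))
          (by positivity) (by positivity)
      _ = _ := by rw [hd, pow_add]; ring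
  have hcodeword : (2 : ℝ) ^ (-(n * entropy (margFst J))) ≤ 1 / #(typeClass n (margFst J)) := by
    rw [Real.rpow_neg zero_le_two, one_div]
    exact inv_anti₀ (by exact_mod_cast card_pos.2 ⟨x₀.1, x₀.2⟩) (card_typeClass_le n _)
  calc _ ≤ 1 / (#(typeClass n (margFst J)) : ℝ) * (4 * ((n : ℝ) + 1) ^ d * min 1 (#N * q)) :=
        mul_le_mul hcodeword (two_rpow_neg_mul_max_le (by linarith) hcollisions)
          (by positivity) (by positivity)
    _ = 12 * ((n : ℝ) + 1) ^ d *
        (1 / (#(typeClass n (margFst J)) : ℝ) * (min 1 (#N * q) / 3)) := by ring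
    _ ≤ _ := mul_le_mul_of_nonneg_left hexpect (by positivity)

theorem card_mul_card_mul_le_errorProb {P : U × V → ℝ} (hP : 0 ≤ P) {W : X → Y → ℝ} (hW : 0 ≤ W)
    {R : ℝ} (hR : 0 ≤ R) {p : U × V → ℝ}
    (hp : 2 * ((n : ℝ) + 1) ^ Fintype.card (U × V) ≤ 2 ^ (n * condEntropy p)) {J : X × Y → ℝ}
    {w : ℝ} (hw₀ : 0 ≤ w)
    (hw : ∀ (u : Fin n → U) (v : Fin n → V) (x : Fin n → X) (y : Fin n → Y),
      empJoint u v = p → empJoint x y = J → mapMetric P W u v x y = w)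
    (δ : Decoder U V Y n (numBins R n) (margFst J)) :
    #(typeClass n p) * #(typeClass n J) * (w * (2 ^ (-(n * entropy (margFst J))) *
        2 ^ (-(n * max 0 (min R (mutualInfo J) - condEntropy p))))) ≤
      24 * ((n : ℝ) + 1) ^ (Fintype.card (U × V) + Fintype.card (X × Y)) * errorProb P W δ := by
  set b : ℝ := 2 ^ (-(n * entropy (margFst J))) *
    2 ^ (-(n * max 0 (min R (mutualInfo J) - condEntropy p)))
  refine le_trans ?_ (mul_le_mul_of_nonneg_left
    (sum_half_mul_expect_le_errorProb hP hW hw₀ hw δ) (by positivity))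
  calc (#(typeClass n p) * #(typeClass n J) * (w * b) : ℝ) =
      ∑ v : Fin n → V, ∑ y : Fin n → Y, ∑ _u ∈ condTypeClass v p,
        ∑ x₀ : ↥(typeClass n (margFst J)) with empJoint x₀.1 y = J, w * b := by
        simp only [sum_const, card_filter_empJoint_eq rfl, nsmul_eq_mul, card_typeClass_eq_sum,
          Nat.cast_sum, ← mul_assoc, ← sum_mul, sum_mul_sum]
    _ ≤ _ := by
        simp only [mul_sum]
        refine sum_le_sum fun v _ => sum_le_sum fun y _ => sum_le_sum fun u hu =>
          sum_le_sum fun x₀ hx₀ => ?_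
        exact (mul_le_mul_of_nonneg_left (le_expect_exists_code_mem_of_mem_condTypeClass hR hp hu
          (mem_filter.1 hx₀).2) hw₀).trans_eq (by ring)

theorem two_rpow_neg_jointObjective_le_errorProb {P : U × V → ℝ} (hP : 0 ≤ P) {W : X → Y → ℝ}
    (hW : 0 ≤ W) {R : ℝ} (hR : 0 ≤ R) {p : U × V → ℝ} (hpn : (typeClass n p).Nonempty)
    (hpP : IsDominatedBy p P)
    (hp : 2 * ((n : ℝ) + 1) ^ Fintype.card (U × V) ≤ 2 ^ (n * condEntropy p)) {J : X × Y → ℝ}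
    (hJn : (typeClass n J).Nonempty) (hJW : IsDominatedBy J (Function.uncurry W))
    (δ : Decoder U V Y n (numBins R n) (margFst J)) :
    (2 : ℝ) ^ (-(n * jointObjective P W R (p, J))) ≤
      24 * ((n : ℝ) + 1) ^ (2 * (Fintype.card (U × V) + Fintype.card (X × Y))) *
        errorProb P W δ := by
  set w : ℝ := 2 ^ (-(n * crossEntropy p P)) * 2 ^ (-(n * crossEntropy J (Function.uncurry W)))
    with hw
  set b : ℝ := 2 ^ (-(n * entropy (margFst J))) *
    2 ^ (-(n * max 0 (min R (mutualInfo J) - condEntropy p))) with hb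
  have hmetric : ∀ (u : Fin n → U) (v : Fin n → V) (x : Fin n → X) (y : Fin n → Y),
      empJoint u v = p → empJoint x y = J → mapMetric P W u v x y = w := by
    rintro u v x y rfl rfl
    exact mapMetric_eq_two_rpow hP hW hpP hJW
  calc (2 : ℝ) ^ (-(n * jointObjective P W R (p, J))) =
      2 ^ (n * entropy p) * 2 ^ (n * entropy J) * (w * b) := by
        simp only [hw, hb, ← Real.rpow_add two_pos, jointObjective]
        ring_nf
    _ ≤ ((n : ℝ) + 1) ^ Fintype.card (U × V) * #(typeClass n p) *
        (((n : ℝ) + 1) ^ Fintype.card (X × Y) * #(typeClass n J)) * (w * b) := by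
        gcongr
        exacts [le_card_typeClass hpn, le_card_typeClass hJn]
    _ = ((n : ℝ) + 1) ^ (Fintype.card (U × V) + Fintype.card (X × Y)) *
        (#(typeClass n p) * #(typeClass n J) * (w * b)) := by rw [pow_add]; ring
    _ ≤ ((n : ℝ) + 1) ^ (Fintype.card (U × V) + Fintype.card (X × Y)) * _ :=
        mul_le_mul_of_nonneg_left
          (card_mul_card_mul_le_errorProb hP hW hR hp (by positivity) hmetric δ) (by positivity)
    _ = _ := by rw [two_mul, pow_add _ (_ + _ : ℕ)]; ring

end Converse

/-! ### The minimum defining the exponent -/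

section Continuity

variable {A B : Type*} [Fintype A] [Fintype B]

@[fun_prop]
theorem continuous_entropy : Continuous (entropy : (A → ℝ) → ℝ) := by
  have hmul : Continuous fun t : ℝ => t * Real.logb 2 t := by
    simp only [Real.logb, ← mul_div_assoc]
    exact Real.continuous_mul_log.div_const _
  exact (continuous_finsetSum _ fun a _ => hmul.comp (continuous_apply a)).neg

@[fun_prop]
theorem continuous_margFst {A B : Type*} [Fintype B] :
    Continuous (margFst : (A × B → ℝ) → A → ℝ) := by
  unfold margFst; fun_prop

@[fun_prop]
theorem continuous_margSnd {A B : Type*} [Fintype A] :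
    Continuous (margSnd : (A × B → ℝ) → B → ℝ) := by
  unfold margSnd; fun_prop

@[fun_prop]
theorem continuous_condEntropy : Continuous (condEntropy : (A × B → ℝ) → ℝ) := by
  unfold condEntropy; fun_prop

@[fun_prop]
theorem continuous_mutualInfo : Continuous (mutualInfo : (A × B → ℝ) → ℝ) := by
  unfold mutualInfo; fun_prop

theorem isClosed_setOf_isDominatedBy {A : Type*} (q : A → ℝ) :
    IsClosed {p | IsDominatedBy p q} := by
  simp only [IsDominatedBy, Set.ofPred_forall]
  exact isClosed_iInter fun a => isClosed_iInter fun _ =>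
    isClosed_eq (continuous_apply a) continuous_const

end Continuity

section Channels

variable {X Y : Type*} [Fintype Y]

theorem margFst_joint (Q : X → ℝ) {W : X → Y → ℝ} (hW : ∀ x, W x ∈ stdSimplex ℝ Y) :
    margFst (joint Q W) = Q := by
  funext x
  simp only [margFst, joint, ← mul_sum, (hW x).2, mul_one]

theorem joint_mem_stdSimplex [Fintype X] {Q : X → ℝ} (hQ : Q ∈ stdSimplex ℝ X) {W : X → Y → ℝ}
    (hW : ∀ x, W x ∈ stdSimplex ℝ Y) : joint Q W ∈ stdSimplex ℝ (X × Y) := by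
  refine ⟨fun z => mul_nonneg (hQ.1 _) ((hW _).1 _), ?_⟩
  rw [Fintype.sum_prod_type, ← hQ.2]
  exact sum_congr rfl fun x _ => congrFun (margFst_joint Q hW) x

theorem exists_joint_margFst_eq {W : X → Y → ℝ} (hW : ∀ x, W x ∈ stdSimplex ℝ Y) {J : X × Y → ℝ}
    (hJ : 0 ≤ J) (hJW : IsDominatedBy J (Function.uncurry W)) :
    ∃ W' : X → Y → ℝ, (∀ x, W' x ∈ stdSimplex ℝ Y) ∧ joint (margFst J) W' = J ∧
      IsDominatedBy (Function.uncurry W') (Function.uncurry W) := by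
  classical
  have hmarg : 0 ≤ margFst J := fun x => sum_nonneg fun y _ => hJ _
  refine ⟨fun x => if margFst J x = 0 then W x else fun y => J (x, y) / margFst J x, fun x => ?_,
    ?_, ?_⟩
  · by_cases hx : margFst J x = 0
    · simpa only [hx, if_true] using hW x
    · simp only [hx, if_false]
      refine ⟨fun y => div_nonneg (hJ _) (hmarg x), ?_⟩
      rw [← sum_div]
      exact div_self hx
  · funext ⟨x, y⟩
    by_cases hx : margFst J x = 0
    · have hJ0 := (sum_eq_zero_iff_of_nonneg fun y _ => hJ (x, y)).1 hx y (mem_univ y)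
      simp [joint, hx, hJ0]
    · simp [joint, hx, mul_div_cancel₀]
  · rintro ⟨x, y⟩ hxy
    by_cases hx : margFst J x = 0
    · simpa [hx] using hxy
    · simp [hx, hJW (x, y) hxy]

theorem entropy_joint [Fintype X] (Q : X → ℝ) {W : X → Y → ℝ} (hW : ∀ x, W x ∈ stdSimplex ℝ Y) :
    entropy (joint Q W) = entropy Q + ∑ x, Q x * entropy (W x) := by
  simp only [entropy, Fintype.sum_prod_type, ← sum_neg_distrib, ← sum_add_distrib]
  refine sum_congr rfl fun x _ => ?_
  have hterm : ∀ y, joint Q W (x, y) * Real.logb 2 (joint Q W (x, y)) =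
      W x y * (Q x * Real.logb 2 (Q x)) + Q x * (W x y * Real.logb 2 (W x y)) := by
    intro y
    by_cases hx : Q x = 0
    · simp [joint, hx]
    by_cases hy : W x y = 0
    · simp [joint, hy]
    rw [joint, Real.logb_mul hx hy]
    ring
  simp only [hterm, sum_neg_distrib, sum_add_distrib, ← sum_mul, ← mul_sum, (hW x).2]
  ring

theorem crossEntropy_joint [Fintype X] (Q : X → ℝ) (W' W : X → Y → ℝ) :
    crossEntropy (joint Q W') (Function.uncurry W) = ∑ x, Q x * crossEntropy (W' x) (W x) := by
  simp only [crossEntropy, joint, Fintype.sum_prod_type, Function.uncurry_apply_pair, mul_assoc,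
    ← mul_sum, mul_neg, sum_neg_distrib]

end Channels

section Divergence

theorem ereal_sum_ne_bot {ι : Type*} {s : Finset ι} {f : ι → EReal} (hf : ∀ i ∈ s, f i ≠ ⊥) :
    ∑ i ∈ s, f i ≠ ⊥ :=
  sum_induction f (· ≠ ⊥) (fun _ _ ha hb => EReal.add_ne_bot_iff.2 ⟨ha, hb⟩) EReal.zero_ne_bot hf

theorem ereal_sum_eq_top {ι : Type*} {s : Finset ι} {f : ι → EReal} (hf : ∀ i ∈ s, f i ≠ ⊥) {i : ι}
    (hi : i ∈ s) (htop : f i = ⊤) : ∑ i ∈ s, f i = ⊤ := by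
  classical
  rw [← add_sum_erase s f hi, htop]
  exact EReal.top_add_of_ne_bot (ereal_sum_ne_bot fun j hj => hf j (mem_of_mem_erase hj))

theorem ereal_coe_sum {ι : Type*} (s : Finset ι) (f : ι → ℝ) :
    ((∑ i ∈ s, f i : ℝ) : EReal) = ∑ i ∈ s, (f i : EReal) :=
  map_sum (⟨⟨Real.toEReal, EReal.coe_zero⟩, EReal.coe_add⟩ : ℝ →+ EReal) f s

variable {A X Y : Type*} [Fintype A] [Fintype X] [Fintype Y]

theorem relEntropy_eq_coe {p q : A → ℝ} (h : IsDominatedBy p q) :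
    relEntropy p q = ((crossEntropy p q - entropy p : ℝ) : EReal) := by
  refine (if_pos h).trans ?_
  rw [crossEntropy, entropy, sub_neg_eq_add, neg_add_eq_sub, ← sum_sub_distrib]
  refine congrArg _ (sum_congr rfl fun a _ => ?_)
  by_cases hp : p a = 0
  · simp [hp]
  · rw [Real.logb_div hp (mt (h a) hp), mul_sub]

theorem relEntropy_eq_top {p q : A → ℝ} (h : ¬IsDominatedBy p q) : relEntropy p q = ⊤ :=
  if_neg h

theorem relEntropy_ne_bot (p q : A → ℝ) : relEntropy p q ≠ ⊥ := by
  unfold relEntropy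
  split_ifs
  exacts [EReal.coe_ne_bot _, top_ne_bot]

theorem coe_mul_relEntropy_ne_bot {c : ℝ} (hc : 0 ≤ c) (p q : A → ℝ) :
    (c : EReal) * relEntropy p q ≠ ⊥ := by
  rw [EReal.mul_ne_bot]
  simp [relEntropy_ne_bot, hc]

variable {W' W : X → Y → ℝ} {Q : X → ℝ}

theorem condRelEntropy_eq_coe (hW' : ∀ x, W' x ∈ stdSimplex ℝ Y)
    (h : IsDominatedBy (joint Q W') (Function.uncurry W)) :
    condRelEntropy W' W Q = ((crossEntropy (joint Q W') (Function.uncurry W) -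
      (entropy (joint Q W') - entropy (margFst (joint Q W'))) : ℝ) : EReal) := by
  rw [margFst_joint Q hW', entropy_joint Q hW', add_sub_cancel_left, crossEntropy_joint,
    ← sum_sub_distrib, ereal_coe_sum, condRelEntropy]
  refine sum_congr rfl fun x _ => ?_
  by_cases hx : Q x = 0
  · simp [hx]
  · have hdom : IsDominatedBy (W' x) (W x) := fun y hy =>
      (mul_eq_zero.1 (h (x, y) hy)).resolve_left hx
    rw [relEntropy_eq_coe hdom, ← mul_sub, EReal.coe_mul]

theorem condRelEntropy_ne_bot (hQ : 0 ≤ Q) : condRelEntropy W' W Q ≠ ⊥ :=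
  ereal_sum_ne_bot fun x _ => coe_mul_relEntropy_ne_bot (hQ x) _ _

theorem condRelEntropy_eq_top (hQ : 0 ≤ Q)
    (h : ¬IsDominatedBy (joint Q W') (Function.uncurry W)) : condRelEntropy W' W Q = ⊤ := by
  simp only [IsDominatedBy, not_forall, exists_prop] at h
  obtain ⟨⟨x, y⟩, hxy, hne⟩ := h
  have hx : 0 < Q x := (hQ x).lt_of_ne' (left_ne_zero_of_mul hne)
  have htop : ¬IsDominatedBy (W' x) (W x) := fun hdom => right_ne_zero_of_mul hne (hdom y hxy)
  refine ereal_sum_eq_top (fun x _ => coe_mul_relEntropy_ne_bot (hQ x) _ _) (mem_univ x) ?_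
  rw [relEntropy_eq_top htop, EReal.coe_mul_top_of_pos hx]

end Divergence

section Minimum

variable {U V X Y : Type*} [Fintype U] [Fintype V] [Fintype X] [Fintype Y] {P : U × V → ℝ}
  {W : X → Y → ℝ} {Q : X → ℝ} {R : ℝ}

theorem continuous_jointObjective (P : U × V → ℝ) (W : X → Y → ℝ) (R : ℝ) :
    Continuous (jointObjective P W R) := by
  unfold jointObjective crossEntropy; fun_prop

theorem isCompact_feasiblePairs (P : U × V → ℝ) (W : X → Y → ℝ) : IsCompact (feasiblePairs P W) :=
  ((isCompact_stdSimplex ℝ _).inter_right (isClosed_setOf_isDominatedBy P)).prod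
    ((isCompact_stdSimplex ℝ _).inter_right (isClosed_setOf_isDominatedBy _))

theorem exists_isLeast_jointValues (hP : P ∈ stdSimplex ℝ (U × V))
    (hW : ∀ x, W x ∈ stdSimplex ℝ Y) (hQ : Q ∈ stdSimplex ℝ X) (R : ℝ) :
    ∃ E, IsLeast (jointValues P W Q R) E := by
  have hcompact : IsCompact {z ∈ feasiblePairs P W | margFst z.2 = Q} :=
    (isCompact_feasiblePairs P W).inter_right
      (isClosed_eq (continuous_margFst.comp continuous_snd) continuous_const)
  have hmem : (P, joint Q W) ∈ {z ∈ feasiblePairs P W | margFst z.2 = Q} :=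
    ⟨⟨⟨hP, fun _ => id⟩, joint_mem_stdSimplex hQ hW, fun _ hW0 => mul_eq_zero_of_right _ hW0⟩,
      margFst_joint Q hW⟩
  exact (hcompact.image (continuous_jointObjective P W R)).exists_isLeast ⟨_, _, hmem, rfl⟩

theorem exponentObjective_eq_coe {P' : U × V → ℝ} (hP' : IsDominatedBy P' P) {W' : X → Y → ℝ}
    (hW' : ∀ x, W' x ∈ stdSimplex ℝ Y) (h : IsDominatedBy (joint Q W') (Function.uncurry W)) :
    exponentObjective P W Q R P' W' = (jointObjective P W R (P', joint Q W') : EReal) := by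
  rw [exponentObjective, relEntropy_eq_coe hP', condRelEntropy_eq_coe hW' h, jointObjective,
    EReal.coe_add, EReal.coe_add]

theorem exponentObjective_eq_top (hQ : 0 ≤ Q) {P' : U × V → ℝ} {W' : X → Y → ℝ}
    (h : ¬(IsDominatedBy P' P ∧ IsDominatedBy (joint Q W') (Function.uncurry W))) :
    exponentObjective P W Q R P' W' = ⊤ := by
  suffices hsum : relEntropy P' P + condRelEntropy W' W Q = ⊤ by
    rw [exponentObjective, hsum]
    exact EReal.top_add_of_ne_bot (EReal.coe_ne_bot _)
  rcases not_and_or.1 h with hP' | hW'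
  · rw [relEntropy_eq_top hP', EReal.top_add_of_ne_bot (condRelEntropy_ne_bot hQ)]
  · rw [condRelEntropy_eq_top hQ hW', EReal.add_top_of_ne_bot (relEntropy_ne_bot _ _)]

theorem isLeast_exponentValues (hW : ∀ x, W x ∈ stdSimplex ℝ Y) (hQ : Q ∈ stdSimplex ℝ X) {E : ℝ}
    (hE : IsLeast (jointValues P W Q R) E) :
    IsLeast (exponentValues P W Q R) (E : EReal) := by
  obtain ⟨⟨⟨P₀, J₀⟩, ⟨⟨hP₀, hJ₀⟩, rfl⟩, rfl⟩, hmin⟩ := hE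
  constructor
  · obtain ⟨W', hW', hJ, -⟩ := exists_joint_margFst_eq hW hJ₀.1.1 hJ₀.2
    refine ⟨P₀, hP₀.1, W', hW', ?_⟩
    rw [exponentObjective_eq_coe hP₀.2 hW' (hJ.symm ▸ hJ₀.2), hJ]
  · rintro _ ⟨P', hP', W', hW', rfl⟩
    by_cases h : IsDominatedBy P' P ∧ IsDominatedBy (joint (margFst J₀) W') (Function.uncurry W)
    · rw [exponentObjective_eq_coe h.1 hW' h.2, EReal.coe_le_coe_iff]
      exact hmin ⟨(P', _), ⟨⟨⟨hP', h.1⟩, joint_mem_stdSimplex hQ hW', h.2⟩, margFst_joint _ hW'⟩,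
        rfl⟩
    · rw [exponentObjective_eq_top hQ.1 h]
      exact le_top

/-- By compactness, the input distributions at which some value is at most `E - ε` form a closed
set, and `Q` is not in it. -/
theorem eventually_mem_lowerBounds_jointValues {ι : Type*} {l : Filter ι} {Qt : ι → X → ℝ}
    (hQt : Tendsto Qt l (𝓝 Q)) {E : ℝ} (hE : E ∈ lowerBounds (jointValues P W Q R)) {ε : ℝ}
    (hε : 0 < ε) : ∀ᶠ k in l, E - ε ∈ lowerBounds (jointValues P W (Qt k) R) := by
  set low := {z ∈ feasiblePairs P W | jointObjective P W R z ≤ E - ε}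
  have hclosed : IsClosed ((fun z => margFst z.2) '' low) :=
    (((isCompact_feasiblePairs P W).inter_right
      (isClosed_le (continuous_jointObjective P W R) continuous_const)).image
        (by fun_prop)).isClosed
  have hQ : Q ∉ (fun z => margFst z.2) '' low := by
    rintro ⟨z, ⟨hz, hle⟩, hzQ⟩
    exact (sub_lt_self E hε).not_ge ((hE ⟨z, ⟨hz, hzQ⟩, rfl⟩).trans hle)
  filter_upwards [hQt.eventually (hclosed.isOpen_compl.mem_nhds hQ)] with k hk
  rintro _ ⟨z, ⟨hz, hzQ⟩, rfl⟩
  by_contra! hlt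
  exact hk ⟨z, ⟨hz, hlt.le⟩, hzQ⟩

end Minimum

/-! ### Positive conditional entropy -/

section CondEntropyPos

variable {U V : Type*} [Fintype U] {p q : U × V → ℝ}

theorem le_margSnd (hp : 0 ≤ p) (a : U × V) : p a ≤ margSnd p a.2 :=
  single_le_sum (f := fun u => p (u, a.2)) (fun _ _ => hp _) (mem_univ a.1)

theorem margSnd_lineMap (p q : U × V → ℝ) (t : ℝ) :
    margSnd (AffineMap.lineMap p q t) = AffineMap.lineMap (margSnd p) (margSnd q) t := by
  funext v
  simp [margSnd, AffineMap.lineMap_apply_module, sum_add_distrib, mul_sum]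

variable [Fintype V]

theorem condEntropy_eq_sum (p : U × V → ℝ) :
    condEntropy p = ∑ a, p a * (Real.logb 2 (margSnd p a.2) - Real.logb 2 (p a)) := by
  have hmarg : ∑ a : U × V, p a * Real.logb 2 (margSnd p a.2) =
      ∑ v, margSnd p v * Real.logb 2 (margSnd p v) := by
    rw [Fintype.sum_prod_type, sum_comm]
    exact sum_congr rfl fun v _ => (sum_mul _ (fun u => p (u, v)) (Real.logb 2 (margSnd p v))).symm
  simp only [mul_sub, sum_sub_distrib, hmarg, condEntropy, entropy]
  ring

theorem condEntropy_pos_iff (hp : 0 ≤ p) :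
    0 < condEntropy p ↔ ∃ a, 0 < p a ∧ p a < margSnd p a.2 := by
  have hnn : ∀ a ∈ univ, 0 ≤ p a * (Real.logb 2 (margSnd p a.2) - Real.logb 2 (p a)) := by
    intro a _
    rcases (hp a).eq_or_lt' with h0 | hpos
    · simp [h0]
    · exact mul_nonneg hpos.le
        (sub_nonneg.2 (Real.logb_le_logb_of_le one_lt_two hpos (le_margSnd hp a)))
  rw [condEntropy_eq_sum, sum_pos_iff_of_nonneg hnn]
  refine exists_congr fun a => ⟨fun ⟨_, h⟩ => ?_, fun ⟨hpos, hlt⟩ => ⟨mem_univ a, mul_pos hpos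
    (sub_pos.2 (Real.logb_lt_logb one_lt_two hpos hlt))⟩⟩
  refine ⟨(hp a).lt_of_ne' (left_ne_zero_of_mul h.ne'), (le_margSnd hp a).lt_of_ne fun heq => ?_⟩
  rw [← heq, sub_self, mul_zero] at h
  exact h.false

theorem condEntropy_lineMap_pos (hp : 0 ≤ p) (hq : 0 ≤ q) (h : 0 < condEntropy q) {t : ℝ}
    (ht : t ∈ Set.Ioc 0 1) : 0 < condEntropy (AffineMap.lineMap p q t) := by
  have ht' : 0 ≤ 1 - t := sub_nonneg.2 ht.2
  obtain ⟨a, ha, hlt⟩ := (condEntropy_pos_iff hq).1 h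
  refine (condEntropy_pos_iff fun b => ?_).2 ⟨a, ?_, ?_⟩
  · simpa [AffineMap.lineMap_apply_module] using
      add_nonneg (mul_nonneg ht' (hp b)) (mul_nonneg ht.1.le (hq b))
  · simpa [AffineMap.lineMap_apply_module] using
      add_pos_of_nonneg_of_pos (mul_nonneg ht' (hp a)) (mul_pos ht.1 ha)
  · rw [margSnd_lineMap]
    simpa [AffineMap.lineMap_apply_module] using add_lt_add_of_le_of_lt
      (mul_le_mul_of_nonneg_left (le_margSnd hp a) ht') (mul_lt_mul_of_pos_left hlt ht.1)

/-- The source distribution of the pair is moved slightly towards `P`. -/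
theorem exists_condEntropy_pos_jointObjective_lt {X Y : Type*} [Fintype X] [Fintype Y]
    {P : U × V → ℝ} (hP : P ∈ stdSimplex ℝ (U × V)) (hH : 0 < condEntropy P) {W : X → Y → ℝ}
    {R : ℝ} {z : (U × V → ℝ) × (X × Y → ℝ)} (hz : z ∈ feasiblePairs P W) {e : ℝ}
    (he : jointObjective P W R z < e) :
    ∃ p, (p, z.2) ∈ feasiblePairs P W ∧ 0 < condEntropy p ∧ jointObjective P W R (p, z.2) < e := by
  have hcont : Continuous fun t : ℝ =>
      jointObjective P W R (AffineMap.lineMap z.1 P t, z.2) :=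
    (continuous_jointObjective P W R).comp
      (AffineMap.lineMap_continuous.prodMk continuous_const)
  have hlt : ∀ᶠ t : ℝ in 𝓝[>] 0, jointObjective P W R (AffineMap.lineMap z.1 P t, z.2) < e :=
    (hcont.tendsto' 0 _ (by simp)).mono_left nhdsWithin_le_nhds |>.eventually_lt_const he
  obtain ⟨t, ht, ht01⟩ := (hlt.and (Ioc_mem_nhdsGT zero_lt_one)).exists
  refine ⟨_, ⟨⟨(convex_stdSimplex ℝ _).lineMap_mem hz.1.1 hP ⟨ht01.1.le, ht01.2⟩, fun a ha => ?_⟩,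
    hz.2⟩, condEntropy_lineMap_pos hz.1.1.1 hP.1 hH ht01, ht⟩
  simp [AffineMap.lineMap_apply_module, ha, hz.1.2 a ha]

end CondEntropyPos

/-! ### Asymptotics -/

section Exponents

theorem tendsto_logb_mul_pow_div_atTop {K : ℝ} (hK : K ≠ 0) (d : ℕ) :
    Tendsto (fun n : ℕ => Real.logb 2 (K * ((n : ℝ) + 1) ^ d) / n) atTop (𝓝 0) := by
  have hlog : Tendsto (fun n : ℕ => Real.logb 2 ((n : ℝ) + 1) / n) atTop (𝓝 0) := by
    have h := (Real.tendsto_pow_log_div_mul_add_atTop (Real.log 2) (-Real.log 2) 1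
      (Real.log_pos one_lt_two).ne').comp
        (tendsto_atTop_add_const_right _ 1 tendsto_natCast_atTop_atTop)
    refine h.congr fun n => ?_
    rw [Function.comp_apply, pow_one, Real.logb, div_div]
    ring_nf
  have hsum := (tendsto_const_div_atTop_nhds_zero_nat (Real.logb 2 K)).add (hlog.const_mul (d : ℝ))
  rw [mul_zero, add_zero] at hsum
  refine hsum.congr fun n => ?_
  rw [Real.logb_mul hK (by positivity), Real.logb_pow, add_div, mul_div_assoc]

variable {p c e : ℝ} {n : ℕ}

theorem sub_logb_div_le_neg_logb_div (hn : n ≠ 0) (hp : 0 < p) (hc : 0 < c)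
    (h : p ≤ c * 2 ^ (-(n * e))) : e - Real.logb 2 c / n ≤ -Real.logb 2 p / n := by
  have hn' : (0 : ℝ) < n := by positivity
  have hlog := Real.logb_le_logb_of_le one_lt_two hp h
  rw [Real.logb_mul hc.ne' (by positivity), Real.logb_rpow two_pos (by norm_num)] at hlog
  rw [sub_le_iff_le_add, ← add_div, le_div_iff₀ hn']
  linarith

theorem neg_logb_div_le_add_logb_div (hn : n ≠ 0) (hp : 0 < p) (hc : 0 < c)
    (h : 2 ^ (-(n * e)) ≤ c * p) : -Real.logb 2 p / n ≤ e + Real.logb 2 c / n := by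
  have hn' : (0 : ℝ) < n := by positivity
  have hlog := Real.logb_le_logb_of_le one_lt_two (by positivity) h
  rw [Real.logb_mul hc.ne' hp.ne', Real.logb_rpow two_pos (by norm_num)] at hlog
  rw [← sub_le_iff_le_add, ← sub_div, div_le_iff₀ hn']
  linarith

theorem hasExponent_of_le_of_le {n : ℕ → ℕ} (hn : Tendsto n atTop atTop) {p : ℕ → ℝ} {E : ℝ}
    {K₁ K₂ : ℝ} (hK₁ : 0 < K₁) (hK₂ : 0 < K₂) {d₁ d₂ : ℕ}
    (hle : ∀ e < E, ∀ᶠ k in atTop, p k ≤ K₁ * ((n k : ℝ) + 1) ^ d₁ * 2 ^ (-(n k * e)))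
    (hge : ∀ e > E, ∀ᶠ k in atTop, 2 ^ (-(n k * e)) ≤ K₂ * ((n k : ℝ) + 1) ^ d₂ * p k) :
    HasExponent n p E := by
  have hpos : ∀ᶠ k in atTop, 0 < p k := by
    filter_upwards [hge (E + 1) (lt_add_one E)] with k hk
    exact pos_of_mul_pos_right (lt_of_lt_of_le (by positivity) hk) (by positivity)
  have hn0 := hn.eventually_ne_atTop 0
  refine ⟨hpos, tendsto_order.2 ⟨fun a ha => ?_, fun a ha => ?_⟩⟩
  · obtain ⟨e, hae, heE⟩ := exists_between ha
    filter_upwards [hpos, hn0, hle e heE, ((tendsto_logb_mul_pow_div_atTop hK₁.ne' d₁).comp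
      hn).eventually_lt_const (sub_pos.2 hae)] with k hk hk0 hk1 hk2
    exact (lt_sub_comm.1 hk2).trans_le
      (sub_logb_div_le_neg_logb_div hk0 hk (by positivity) hk1)
  · obtain ⟨e, hEe, hea⟩ := exists_between ha
    filter_upwards [hpos, hn0, hge e hEe, ((tendsto_logb_mul_pow_div_atTop hK₂.ne' d₂).comp
      hn).eventually_lt_const (sub_pos.2 hea)] with k hk hk0 hk1 hk2
    exact (neg_logb_div_le_add_logb_div hk0 hk (by positivity) hk1).trans_lt
      (lt_sub_iff_add_lt'.1 hk2)

theorem eventually_mul_pow_le_two_rpow {K : ℝ} (hK : 0 < K) (d : ℕ) {n : ℕ → ℕ}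
    (hn : Tendsto n atTop atTop) {h : ℕ → ℝ} {h₀ : ℝ} (hh : Tendsto h atTop (𝓝 h₀))
    (hh₀ : 0 < h₀) : ∀ᶠ k in atTop, K * ((n k : ℝ) + 1) ^ d ≤ 2 ^ (n k * h k) := by
  filter_upwards [((tendsto_logb_mul_pow_div_atTop hK.ne' d).comp hn).eventually_lt hh hh₀,
    hn.eventually_gt_atTop 0] with k hk hk0
  rw [← Real.logb_le_iff_le_rpow one_lt_two (by positivity)]
  exact ((div_lt_iff₀' (Nat.cast_pos.2 hk0)).1 hk).le

end Exponents

section TypeSequences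

variable {n : ℕ → ℕ}

theorem tendsto_of_natCast_mul_abs_sub_le {A : Type*} (hn : Tendsto n atTop atTop)
    {f g : ℕ → A → ℝ} {l : A → ℝ} (hg : Tendsto g atTop (𝓝 l)) {c : ℝ}
    (h : ∀ k a, n k * |f k a - g k a| ≤ c) : Tendsto f atTop (𝓝 l) := by
  rw [tendsto_pi_nhds] at hg ⊢
  intro a
  have hsub : Tendsto (fun k => f k a - g k a) atTop (𝓝 0) := by
    refine squeeze_zero_norm' ?_
      ((tendsto_const_nhds (x := c)).div_atTop (tendsto_natCast_atTop_atTop.comp hn))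
    filter_upwards [hn.eventually_gt_atTop 0] with k hk
    exact (le_div_iff₀' (Nat.cast_pos.2 hk)).2 (h k a)
  simpa using hsub.add (hg a)

theorem exists_tendsto_typeClass_nonempty {A : Type*} [Fintype A] [DecidableEq A] {p : A → ℝ}
    (hp : p ∈ stdSimplex ℝ A) (hn : Tendsto n atTop atTop) :
    ∃ pt : ℕ → A → ℝ, (∀ k, (typeClass (n k) (pt k)).Nonempty) ∧
      (∀ k, IsDominatedBy (pt k) p) ∧ Tendsto pt atTop (𝓝 p) := by
  choose pt hpt hdom hle using fun k => exists_typeClass_nonempty_abs_sub_le hp (n k)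
  exact ⟨pt, hpt, hdom, tendsto_of_natCast_mul_abs_sub_le hn tendsto_const_nhds hle⟩

theorem exists_tendsto_typeClass_nonempty_margFst_eq {X Y : Type*} [Fintype X] [Fintype Y]
    [DecidableEq X] [DecidableEq Y] {W : X → Y → ℝ} (hW : ∀ x, W x ∈ stdSimplex ℝ Y)
    {J : X × Y → ℝ} (hJ : 0 ≤ J) (hJW : IsDominatedBy J (Function.uncurry W))
    (hn : Tendsto n atTop atTop) {Qt : ℕ → X → ℝ} (hQt : Tendsto Qt atTop (𝓝 (margFst J)))
    (hne : ∀ k, (typeClass (n k) (Qt k)).Nonempty) :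
    ∃ Jt : ℕ → X × Y → ℝ, (∀ k, (typeClass (n k) (Jt k)).Nonempty) ∧
      (∀ k, margFst (Jt k) = Qt k) ∧ (∀ k, IsDominatedBy (Jt k) (Function.uncurry W)) ∧
      Tendsto Jt atTop (𝓝 J) := by
  obtain ⟨W', hW', hJW', hdom⟩ := exists_joint_margFst_eq hW hJ hJW
  choose Jt hJt hmarg hdom' hle using fun k =>
    exists_typeClass_nonempty_margFst_eq hW' (hne k)
  have hjoint : Tendsto (fun k => joint (Qt k) W') atTop (𝓝 J) := by
    rw [← hJW', tendsto_pi_nhds]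
    exact fun b => ((tendsto_pi_nhds.1 hQt) b.1).mul_const _
  exact ⟨Jt, hJt, hmarg, fun k b hb => hdom' k b (hdom b hb),
    tendsto_of_natCast_mul_abs_sub_le hn hjoint hle⟩

end TypeSequences

section ErrorExponent

theorem exists_isArgmaxDecoder {U V X Y : Type*} [Finite U] [Nonempty U] [Fintype X]
    [DecidableEq X] {n M : ℕ} {Q : X → ℝ}
    (m : (Fin n → U) → (Fin n → V) → (Fin n → X) → (Fin n → Y) → ℝ) :
    ∃ δ : Decoder U V Y n M Q, IsArgmaxDecoder m δ := by
  choose δ hδ using fun (f : Binning U n M) (C : Codebook n M Q) v y =>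
    Finite.exists_max fun u => m u v (C (f u)) y
  exact ⟨δ, hδ⟩

variable {U V X Y : Type*} [Fintype U] [Fintype V] [Fintype X] [Fintype Y] [DecidableEq U]
  [DecidableEq X] {P : U × V → ℝ} {W : X → Y → ℝ} {Q : X → ℝ} {R : ℝ} {n : ℕ → ℕ}
  {Qt : ℕ → X → ℝ}

theorem eventually_two_rpow_le_errorProb (hP : P ∈ stdSimplex ℝ (U × V))
    (hH : 0 < condEntropy P) (hW : ∀ x, W x ∈ stdSimplex ℝ Y) (hR : 0 ≤ R)
    {z : (U × V → ℝ) × (X × Y → ℝ)} (hz : z ∈ feasiblePairs P W) (hn : Tendsto n atTop atTop)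
    (hQt : Tendsto Qt atTop (𝓝 (margFst z.2))) (hne : ∀ k, (typeClass (n k) (Qt k)).Nonempty)
    (δ : ∀ k, Decoder U V Y (n k) (numBins R (n k)) (Qt k)) {e : ℝ}
    (he : jointObjective P W R z < e) :
    ∀ᶠ k in atTop, 2 ^ (-(n k * e)) ≤
      24 * ((n k : ℝ) + 1) ^ (2 * (Fintype.card (U × V) + Fintype.card (X × Y))) *
        errorProb P W (δ k) := by
  classical
  obtain ⟨p, ⟨⟨hp, hpP⟩, hJ, hJW⟩, hpH, hpe⟩ := exists_condEntropy_pos_jointObjective_lt hP hH hz he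
  obtain ⟨pt, hpt, hpt_dom, hpt_lim⟩ := exists_tendsto_typeClass_nonempty hp hn
  obtain ⟨Jt, hJt, hJt_marg, hJt_dom, hJt_lim⟩ :=
    exists_tendsto_typeClass_nonempty_margFst_eq hW hJ.1 hJW hn hQt hne
  obtain rfl : (fun k => margFst (Jt k)) = Qt := funext hJt_marg
  have hlim := ((continuous_jointObjective P W R).tendsto _).comp (hpt_lim.prodMk_nhds hJt_lim)
  filter_upwards [hlim.eventually_lt_const hpe, eventually_mul_pow_le_two_rpow two_pos _ hn
    ((continuous_condEntropy.tendsto p).comp hpt_lim) hpH] with k hk hk_large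
  refine le_trans ?_ (two_rpow_neg_jointObjective_le_errorProb hP.1 (fun x => (hW x).1) hR
    (hpt k) (fun a ha => hpt_dom k a (hpP a ha)) hk_large (hJt k) (hJt_dom k) (δ k))
  have hk' : jointObjective P W R (pt k, Jt k) ≤ e := hk.le
  gcongr
  exact one_le_two

theorem hasExponent_errorProb [DecidableEq V] [DecidableEq Y] (hP : P ∈ stdSimplex ℝ (U × V))
    (hH : 0 < condEntropy P) (hW : ∀ x, W x ∈ stdSimplex ℝ Y) (hR : 0 ≤ R) {E : ℝ}
    (hE : IsLeast (jointValues P W Q R) E) (hn : Tendsto n atTop atTop)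
    (hQt : Tendsto Qt atTop (𝓝 Q)) (hne : ∀ k, (typeClass (n k) (Qt k)).Nonempty)
    {δ δ' : ∀ k, Decoder U V Y (n k) (numBins R (n k)) (Qt k)}
    (hle : ∀ k, errorProb P W (δ k) ≤ errorProb P W (δ' k))
    {m : ∀ k, (Fin (n k) → U) → (Fin (n k) → V) → (Fin (n k) → X) → (Fin (n k) → Y) → ℝ}
    (hm : ∀ k, IsUniversalMetric R (m k)) (hδ' : ∀ k, IsArgmaxDecoder (m k) (δ' k)) :
    HasExponent n (fun k => errorProb P W (δ k)) E := by
  obtain ⟨⟨z, ⟨hz, rfl⟩, rfl⟩, hmin⟩ := hE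
  apply hasExponent_of_le_of_le hn two_pos (by norm_num : (0 : ℝ) < 24)
  · intro e he
    filter_upwards [eventually_mem_lowerBounds_jointValues hQt hmin (sub_pos.2 he),
      hn.eventually_ne_atTop 0] with k hk hk0
    rw [sub_sub_cancel] at hk
    exact (hle k).trans (errorProb_le hP.1 (fun x => (hW x).1) hk0 (hm k) (hδ' k) hk)
  · exact fun e he => eventually_two_rpow_le_errorProb hP hH hW hR hz hn hQt hne δ he

end ErrorExponent

end BinningExponent

end

theorem theorem1 {U V X Y : Type*} [Fintype U] [Fintype V] [Fintype X] [Fintype Y]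
    [DecidableEq U] [DecidableEq V] [DecidableEq X] [DecidableEq Y]
    (P : U × V → ℝ) (hP : P ∈ stdSimplex ℝ (U × V))
    (hH : 0 < BinningExponent.condEntropy P)
    (W : X → Y → ℝ) (hW : ∀ x, W x ∈ stdSimplex ℝ Y)
    (Q : X → ℝ) (hQ : Q ∈ stdSimplex ℝ X) (R : ℝ) (hR : 0 < R) :
    ∃ E : ℝ, IsLeast (BinningExponent.exponentValues P W Q R) (E : EReal) ∧
      ∀ (n : ℕ → ℕ) (Qt : ℕ → X → ℝ), Tendsto n atTop atTop → Tendsto Qt atTop (𝓝 Q) →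
        (∀ k, (BinningExponent.typeClass (n k) (Qt k)).Nonempty) →
        ∀ δ : ∀ k, BinningExponent.Decoder U V Y (n k) (BinningExponent.numBins R (n k)) (Qt k),
          ((∀ k, BinningExponent.IsArgmaxDecoder (BinningExponent.mapMetric P W) (δ k)) →
            BinningExponent.HasExponent n (fun k => BinningExponent.errorProb P W (δ k)) E) ∧
          ((∀ k, BinningExponent.IsArgmaxDecoder BinningExponent.gmmiMetric (δ k)) →
            BinningExponent.HasExponent n (fun k => BinningExponent.errorProb P W (δ k)) E) ∧
          ((∀ k, BinningExponent.IsArgmaxDecoder (BinningExponent.gmmiMetric' R) (δ k)) →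
            BinningExponent.HasExponent n (fun k => BinningExponent.errorProb P W (δ k)) E) := by
  open BinningExponent in
  obtain ⟨E, hE⟩ := exists_isLeast_jointValues hP hW hQ R
  refine ⟨E, isLeast_exponentValues hW hQ hE,
    fun n Qt hn hQt hne δ => ⟨fun hδ => ?_, fun hδ => ?_, fun hδ => ?_⟩⟩
  · obtain ⟨a, -⟩ := (condEntropy_pos_iff hP.1).1 hH
    have : Nonempty U := ⟨a.1⟩
    choose δ' hδ' using fun k => exists_isArgmaxDecoder (M := numBins R (n k)) (Q := Qt k)
      (gmmiMetric (U := U) (V := V) (X := X) (Y := Y) (n := n k))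
    exact hasExponent_errorProb hP hH hW hR.le hE hn hQt hne (fun k => errorProb_map_le (hδ k))
      (fun _ => isUniversalMetric_gmmiMetric R) hδ'
  · exact hasExponent_errorProb hP hH hW hR.le hE hn hQt hne (fun _ => le_rfl)
      (fun _ => isUniversalMetric_gmmiMetric R) hδ
  · exact hasExponent_errorProb hP hH hW hR.le hE hn hQt hne (fun _ => le_rfl)
      (fun _ => isUniversalMetric_gmmiMetric' R) hδ
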